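/- Let $k$ be a field of characteristic $0$ and let $\mathcal{O}$ be a reduced operad (that is, $\mathcal{O}(0)=0$ and $\mathcal{O}(1)=k$) in the category $\mathrm{Ch}_+$ of nonnegatively graded chain complexes over $k$, with differentials of degree $-1$. Let $\mathrm{Alg}_{\mathcal{O}}$ be the category of $\mathcal{O}$-algebras in $\mathrm{Ch}_+$; a morphism is a weak equivalence if it is a quasi-isomorphism, and a fibration if it is surjective in all positive degrees. For a $\mathbb{Z}$-graded chain complex $C$ let $\mathrm{red}_0(C)$ be the nonnegatively graded complex with $\mathrm{red}_0(C)_n=C_n$ for $n>0$ and $\mathrm{red}_0(C)_0=\ker(d\colon C_0\to C_{-1})$. Let $\Lambda(t,dt)=k[t]\oplus k[t]\,dt$ be the free graded commutative differential algebra on $t$ with $|t|=0$, $|dt|=-1$, $d(t)=dt$. For $Z\in\mathrm{Alg}_{\mathcal{O}}$, the complex $\Lambda(t,dt)\otimes Z$ is an $\mathcal{O}$-algebra (in $\mathbb{Z}$-graded complexes) with structure maps $$m(a;\alpha_1\otimes z_1,\dots,\alpha_n\otimes z_n)=\pm(\alpha_1\cdots\alpha_n)\otimes m(a;z_1,\dots,z_n)$$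 (Koszul sign). Put $Z^I=\mathrm{red}_0(\Lambda(t,dt)\otimes Z)\in\mathrm{Alg}_{\mathcal{O}}$, let $p_0,p_1\colon Z^I\to Z$ be induced by the evaluations $P(t)+Q(t)\,dt\mapsto P(0)$, resp. $P(1)$, and let $s_0\colon Z\to Z^I$, $z\mapsto 1\otimes z$. For a diagram $D=(X\xrightarrow{g}Z\xleftarrow{f}Y)$ in $\mathrm{Alg}_{\mathcal{O}}$ let $Z^I\times_Z Y$ be the strict pullback of $p_0$ and $f$, with projection $\pi_1$ to $Z^I$, and let $$P_D=X\times_Z Z^I\times_Z Y=\lim\bigl(X\xrightarrow{\,g\,}Z\xleftarrow{\,p_1\pi_1\,}Z^I\times_Z Y\bigr)$$ be the strict limit. Then: 1. $Z^I$ is a path object for every $Z\in\mathrm{Alg}_{\mathcal{O}}$: $p_0s_0=p_1s_0=\mathrm{id}_Z$; the morphisms $s_0,p_0,p_1$ are weak equivalences; $p_0$ and $p_1$ are surjective; and $(p_0,p_1)\colon Z^I\to Z\times Z$ is surjective in all positive degrees. 2. $P_D$ is the homotopy pullback of $D$: the functor $D\mapsto P_D$ sends objectwise weak equivalences of diagrams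 to weak equivalences, and, together with the natural morphism $c_D\colon X\times_Z Y\to P_D$, $(x,y)\mapsto(x,s_0(f(y)),y)$, it induces on homotopy categories (localizations at the weak equivalences) the total right derived functor of the strict pullback functor $D\mapsto\lim D=X\times_Z Y$. 3. If $\varphi\colon D\to D'$ is an objectwise weak equivalence of diagrams and both morphisms of $D'=(X'\to Z'\leftarrow Y')$ are fibrations, then the maps $P_D\xrightarrow{P_\varphi}P_{D'}\xleftarrow{c_{D'}}\lim D'=X'\times_{Z'}Y'$ are weak equivalences. 4. Every diagram $D$ admits an objectwise weak equivalence $D\to D'$ to a diagram $D'$ as in 3. -/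

import Mathlib

open CategoryTheory TensorProduct

universe u

namespace DGOperad

/-! ### Chain complexes over a field -/

/-- A `ℤ`-graded chain complex over `k`, presented as a vector space with an internal direct sum
decomposition into homogeneous parts and a differential of degree `-1`. -/
structure DGMod (k : Type u) [Field k] where
  carrier : Type u
  [addCommGroup : AddCommGroup carrier]
  [module : Module k carrier]
  /-- the homogeneous part of each degree -/
  gr : ℤ → Submodule k carrier
  isInternal : DirectSum.IsInternal gr
  d : carrier →ₗ[k] carrier
  d_mem : ∀ (n : ℤ) (x : carrier), x ∈ gr (n + 1) → d x ∈ gr n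
  d_d : ∀ x : carrier, d (d x) = 0

attribute [instance] DGMod.addCommGroup DGMod.module

instance (k : Type u) [Field k] : CoeSort (DGMod k) (Type u) := ⟨DGMod.carrier⟩

section Multilinear

variable {k : Type u} [Field k] {V W : Type u} [AddCommGroup V] [Module k V]
  [AddCommGroup W] [Module k W]

theorem multilinear_ext_of_span {n : ℕ} {S : Set V} (hS : Submodule.span k S = ⊤)
    {f g : MultilinearMap k (fun _ : Fin n => V) W}
    (h : ∀ x : Fin n → V, (∀ i, x i ∈ S) → f x = g x) : f = g := by
  have key : ∀ (s : Finset (Fin n)) (x : Fin n → V), (∀ i, i ∉ s → x i ∈ S) → f x = g x := by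
    intro s
    induction s using Finset.induction_on with
    | empty => intro x hx; exact h x (fun i => hx i (by simp))
    | insert i s hi ih =>
      intro x hx
      have : ∀ y : V, f (Function.update x i y) = g (Function.update x i y) := by
        intro y
        have hy : y ∈ Submodule.span k S := by rw [hS]; trivial
        induction hy using Submodule.span_induction with
        | mem y hy =>
          apply ih
          intro j hj
          by_cases hji : j = i
          · subst hji; simpa using hy
          · rw [Function.update_of_ne hji]
            exact hx j (by simp [hji, hj])
        | zero => simp
        | add y z _ _ h1 h2 => simp [h1, h2]
        | smul c y _ h1 => simp [h1]
      simpa using this (x i)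
  ext x
  exact key Finset.univ x (by simp)

theorem isInternal_of_proj (gr : ℤ → Submodule k V) (π : ℤ → V →ₗ[k] V)
    (h1 : ∀ n x, x ∈ gr n → π n x = x) (h0 : ∀ m n x, m ≠ n → x ∈ gr n → π m x = 0)
    (htop : iSup gr = ⊤) : DirectSum.IsInternal gr := by
  refine DirectSum.isInternal_submodule_of_iSupIndep_of_iSup_eq_top ?_ htop
  rw [iSupIndep_def]
  intro n
  rw [Submodule.disjoint_def]
  intro x hx hx'
  have : (⨆ j, ⨆ (_ : j ≠ n), gr j) ≤ LinearMap.ker (π n) := by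
    refine iSup_le fun j => iSup_le fun hj => ?_
    intro y hy
    exact h0 n j y (Ne.symm hj) hy
  have h2 : π n x = 0 := this hx'
  rw [h1 n x hx] at h2
  exact h2

end Multilinear

namespace DGMod

variable {k : Type u} [Field k] (V W : DGMod k)

/-- The projection to the part of degree `n`. -/
noncomputable def proj (n : ℤ) : V →ₗ[k] V :=
  (V.gr n).subtype ∘ₗ DirectSum.component k ℤ (fun i => V.gr i) n ∘ₗ
    (LinearEquiv.ofBijective (DirectSum.coeLinearMap V.gr) V.isInternal).symm.toLinearMap

/-- The linear involution `x ↦ (-1)^n x` for `x` of degree `n`. -/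
noncomputable def sgn : V →ₗ[k] V :=
  (DirectSum.toModule k ℤ V (fun n => ((-1 : k) ^ n) • (V.gr n).subtype)) ∘ₗ
    (LinearEquiv.ofBijective (DirectSum.coeLinearMap V.gr) V.isInternal).symm.toLinearMap

variable {V W}

theorem equiv_symm_of_mem {n : ℤ} {x : V} (hx : x ∈ V.gr n) :
    (LinearEquiv.ofBijective (DirectSum.coeLinearMap V.gr) V.isInternal).symm x =
      DirectSum.lof k ℤ (fun i => V.gr i) n ⟨x, hx⟩ := by
  rw [LinearEquiv.symm_apply_eq]
  exact (DirectSum.coeLinearMap_lof V.gr n ⟨x, hx⟩).symm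

theorem proj_of_mem {n : ℤ} {x : V} (hx : x ∈ V.gr n) : V.proj n x = x := by
  simp only [proj, LinearMap.comp_apply, LinearEquiv.coe_coe, equiv_symm_of_mem hx]
  rw [DirectSum.component.lof_self]
  rfl

theorem proj_of_mem_ne {m n : ℤ} (h : m ≠ n) {x : V} (hx : x ∈ V.gr n) : V.proj m x = 0 := by
  simp only [proj, LinearMap.comp_apply, LinearEquiv.coe_coe, equiv_symm_of_mem hx]
  rw [DirectSum.component.of, dif_neg (Ne.symm h)]
  simp

theorem proj_mem (n : ℤ) (x : V) : V.proj n x ∈ V.gr n :=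
  SetLike.coe_mem _

theorem sgn_of_mem {n : ℤ} {x : V} (hx : x ∈ V.gr n) : V.sgn x = (-1 : k) ^ n • x := by
  simp only [sgn, LinearMap.comp_apply, LinearEquiv.coe_coe, equiv_symm_of_mem hx]
  rw [DirectSum.toModule_lof]
  rfl

variable (V) in
theorem iSup_gr : iSup V.gr = ⊤ := V.isInternal.submodule_iSup_eq_top

variable (V) in
theorem span_gr : Submodule.span k (⋃ n, (V.gr n : Set V)) = ⊤ := by
  rw [← V.iSup_gr, Submodule.iSup_eq_span]

@[elab_as_elim]
theorem induction_gr {p : V → Prop} (x : V) (h : ∀ n x, x ∈ V.gr n → p x)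
    (hadd : ∀ x y, p x → p y → p (x + y)) : p x := by
  have hx : x ∈ iSup V.gr := by rw [V.iSup_gr]; trivial
  exact Submodule.iSup_induction V.gr (motive := p) hx h (h 0 0 (Submodule.zero_mem _)) hadd

theorem linearMap_ext_gr {M : Type u} [AddCommGroup M] [Module k M] {f g : V →ₗ[k] M}
    (h : ∀ n x, x ∈ V.gr n → f x = g x) : f = g := by
  ext x
  induction x using induction_gr with
  | h n x hx => exact h n x hx
  | hadd x y h1 h2 => simp [h1, h2]

theorem multilinear_ext_gr {n : ℕ} {M : Type u} [AddCommGroup M] [Module k M]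
    {f g : MultilinearMap k (fun _ : Fin n => (V : Type u)) M}
    (h : ∀ (q : Fin n → ℤ) (x : Fin n → V), (∀ i, x i ∈ V.gr (q i)) → f x = g x) : f = g := by
  refine multilinear_ext_of_span V.span_gr fun x hx => ?_
  simp only [Set.mem_iUnion, SetLike.mem_coe] at hx
  choose q hq using hx
  exact h q x hq

theorem sgn_mem {n : ℤ} {x : V} (hx : x ∈ V.gr n) : V.sgn x ∈ V.gr n := by
  rw [sgn_of_mem hx]; exact Submodule.smul_mem _ _ hx

theorem neg_one_zpow_mul_self (n : ℤ) : (-1 : k) ^ n * (-1 : k) ^ n = 1 := by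
  rw [← mul_zpow]; simp

@[simp] theorem sgn_sgn (x : V) : V.sgn (V.sgn x) = x := by
  induction x using induction_gr with
  | h n x hx =>
    rw [sgn_of_mem hx, map_smul, sgn_of_mem hx, smul_smul, neg_one_zpow_mul_self, one_smul]
  | hadd x y h1 h2 => simp [h1, h2]

theorem d_mem' {n : ℤ} {x : V} (hx : x ∈ V.gr n) : V.d x ∈ V.gr (n - 1) :=
  V.d_mem (n - 1) x (by simpa using hx)

theorem d_sgn (x : V) : V.d (V.sgn x) = - V.sgn (V.d x) := by
  induction x using induction_gr with
  | h n x hx =>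
    rw [sgn_of_mem hx, map_smul, sgn_of_mem (d_mem' hx), zpow_sub₀ (by simp), zpow_one, div_neg, div_one, neg_smul, neg_neg]
  | hadd x y h1 h2 => simp only [map_add, h1, h2]; abel

/-- Morphisms of chain complexes: linear maps of degree `0` commuting with differentials. -/
@[ext] structure Hom (V W : DGMod k) where
  toLin : V →ₗ[k] W
  map_gr : ∀ (n : ℤ) (x : V), x ∈ V.gr n → toLin x ∈ W.gr n
  map_d : ∀ x : V, toLin (V.d x) = W.d (toLin x)

theorem Hom.map_sgn (f : Hom V W) (x : V) : f.toLin (V.sgn x) = W.sgn (f.toLin x) := by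
  induction x using induction_gr with
  | h n x hx => rw [sgn_of_mem hx, sgn_of_mem (f.map_gr n x hx), map_smul]
  | hadd x y h1 h2 => simp only [map_add, h1, h2]

theorem Hom.map_proj (f : Hom V W) (n : ℤ) (x : V) :
    f.toLin (V.proj n x) = W.proj n (f.toLin x) := by
  induction x using induction_gr with
  | h m x hx =>
    by_cases h : n = m
    · subst h; rw [proj_of_mem hx, proj_of_mem (f.map_gr n x hx)]
    · rw [proj_of_mem_ne h hx, proj_of_mem_ne h (f.map_gr m x hx), map_zero]
  | hadd x y h1 h2 => simp only [map_add, h1, h2]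

/-- The complex is concentrated in nonnegative degrees. -/
def IsNonneg (V : DGMod k) : Prop := ∀ n : ℤ, n < 0 → V.gr n = ⊥

/-! Homology in degree `n`: cycles of degree `n` modulo the image of the part of degree `n + 1`. -/

/-- The cycles of degree `n`. -/
def cycles (V : DGMod k) (n : ℤ) : Submodule k V := V.gr n ⊓ LinearMap.ker V.d

/-- The boundaries of degree `n`, as a subspace of the cycles. -/
def boundaries (V : DGMod k) (n : ℤ) : Submodule k (V.cycles n) :=
  ((V.gr (n + 1)).map V.d).comap (V.cycles n).subtype

/-- The homology of degree `n`. -/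
abbrev homology (V : DGMod k) (n : ℤ) : Type u := V.cycles n ⧸ V.boundaries n

/-- The map induced on cycles. -/
def Hom.cyclesMap (f : Hom V W) (n : ℤ) : V.cycles n →ₗ[k] W.cycles n :=
  f.toLin.restrict (p := V.cycles n) (q := W.cycles n) (fun x hx =>
    ⟨f.map_gr n x hx.1, by
      have h : V.d x = 0 := hx.2
      change W.d (f.toLin x) = 0
      rw [← f.map_d, h, map_zero]⟩)

/-- The map induced on homology. -/
def Hom.homologyMap (f : Hom V W) (n : ℤ) : V.homology n →ₗ[k] W.homology n :=
  Submodule.mapQ (V.boundaries n) (W.boundaries n) (f.cyclesMap n) (by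
    rintro ⟨x, hx⟩ ⟨y, hy, hyx⟩
    exact ⟨f.toLin y, f.map_gr _ y hy, by
      rw [← f.map_d, hyx]; rfl⟩)

/-- A morphism is a quasi-isomorphism if it induces bijections on all homology spaces. -/
def Hom.IsQuasiIso (f : Hom V W) : Prop := ∀ n : ℤ, Function.Bijective (f.homologyMap n)

end DGMod

/-! ### Operads -/

section Reindex

variable {A B C : Type}

/-- `(Option B) ⊕ A ≃ Option (B ⊕ A)`, the point of `Option B` becoming the point. -/
def optionSum : Option B ⊕ A ≃ Option (B ⊕ A) where
  toFun
    | .inl none => none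
    | .inl (some b) => some (.inl b)
    | .inr a => some (.inr a)
  invFun
    | none => .inl none
    | some (.inl b) => .inl (some b)
    | some (.inr a) => .inr a
  left_inv := by rintro ((_ | _) | _) <;> rfl
  right_inv := by rintro (_ | (_ | _)) <;> rfl

/-- `B ⊕ (Option A) ≃ Option (B ⊕ A)`, the point of `Option A` becoming the point. -/
def sumOption : B ⊕ Option A ≃ Option (B ⊕ A) where
  toFun
    | .inr none => none
    | .inl b => some (.inl b)
    | .inr (some a) => some (.inr a)
  invFun
    | none => .inr none
    | some (.inl b) => .inl b
    | some (.inr a) => .inr (some a)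
  left_inv := by rintro (_ | (_ | _)) <;> rfl
  right_inv := by rintro (_ | (_ | _)) <;> rfl

/-- Exchange of the two distinguished points of `Option (Option A)`. -/
def optionSwap : Option (Option A) ≃ Option (Option A) where
  toFun
    | none => some none
    | some none => none
    | some (some a) => some (some a)
  invFun
    | none => some none
    | some none => none
    | some (some a) => some (some a)
  left_inv := by rintro (_ | (_ | _)) <;> rfl
  right_inv := by rintro (_ | (_ | _)) <;> rfl

/-- `Option A ≃ Unit ⊕ A`. -/
def optionUnit : Option A ≃ Unit ⊕ A where
  toFun
    | none => .inl ()
    | some a => .inr a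
  invFun
    | .inl _ => none
    | .inr a => some a
  left_inv := by rintro (_ | _) <;> rfl
  right_inv := by rintro (_ | _) <;> rfl

/-- `Unit ≃ Option Empty`. -/
def unitOption : Unit ≃ Option Empty where
  toFun _ := none
  invFun _ := ()
  left_inv := by rintro ⟨⟩; rfl
  right_inv := by rintro (_ | x); rfl; exact x.elim

/-- `C ⊕ (B ⊕ A) ≃ B ⊕ (C ⊕ A)`. -/
def sumLeftComm : C ⊕ (B ⊕ A) ≃ B ⊕ (C ⊕ A) where
  toFun
    | .inl c => .inr (.inl c)
    | .inr (.inl b) => .inl b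
    | .inr (.inr a) => .inr (.inr a)
  invFun
    | .inr (.inl c) => .inl c
    | .inl b => .inr (.inl b)
    | .inr (.inr a) => .inr (.inr a)
  left_inv := by rintro (_ | (_ | _)) <;> rfl
  right_inv := by rintro (_ | (_ | _)) <;> rfl

end Reindex

/-- A symmetric operad in nonnegatively graded chain complexes over `k`: a functor `J ↦ O(J)`
on finite sets and bijections, with partial compositions.  An element of `O(J)` has inputs
labelled by `J`; for `a ∈ O(Option A)` and `b ∈ O(B)`, `comp a b ∈ O(B ⊕ A)` is obtained by
plugging `b` into the input `none` of `a`.  (Every pointed finite set is of the form `Option A`, so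
this gives, by functoriality, the composition `a ∘ᵢ b` at an arbitrary input `i`.) -/
structure Operad (k : Type u) [Field k] where
  obj (J : Type) [Finite J] : DGMod k
  nonneg (J : Type) [Finite J] : (obj J).IsNonneg
  map {J J' : Type} [Finite J] [Finite J'] (σ : J ≃ J') : (obj J).Hom (obj J')
  map_refl {J : Type} [Finite J] (a : obj J) : (map (Equiv.refl J)).toLin a = a
  map_trans {J J' J'' : Type} [Finite J] [Finite J'] [Finite J''] (σ : J ≃ J') (τ : J' ≃ J'')
    (a : obj J) : (map (σ.trans τ)).toLin a = (map τ).toLin ((map σ).toLin a)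
  /-- the unit operation -/
  one : obj Unit
  one_mem : one ∈ (obj Unit).gr 0
  d_one : (obj Unit).d one = 0
  /-- partial composition at the distinguished input -/
  comp {A B : Type} [Finite A] [Finite B] : obj (Option A) →ₗ[k] obj B →ₗ[k] obj (B ⊕ A)
  comp_mem {A B : Type} [Finite A] [Finite B] (p q : ℤ) (a : obj (Option A)) (b : obj B) :
    a ∈ (obj (Option A)).gr p → b ∈ (obj B).gr q → comp a b ∈ (obj (B ⊕ A)).gr (p + q)
  d_comp {A B : Type} [Finite A] [Finite B] (a : obj (Option A)) (b : obj B) :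
    (obj (B ⊕ A)).d (comp a b) =
      comp ((obj (Option A)).d a) b + comp ((obj (Option A)).sgn a) ((obj B).d b)
  /-- equivariance -/
  map_comp {A A' B B' : Type} [Finite A] [Finite A'] [Finite B] [Finite B'] (σ : A ≃ A')
    (τ : B ≃ B') (a : obj (Option A)) (b : obj B) :
    (map (Equiv.sumCongr τ σ)).toLin (comp a b) =
      comp ((map (Equiv.optionCongr σ)).toLin a) ((map τ).toLin b)
  /-- right unit -/
  comp_one {A : Type} [Finite A] (a : obj (Option A)) :
    comp a one = (map optionUnit).toLin a
  /-- left unit -/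
  one_comp {B : Type} [Finite B] (b : obj B) :
    comp ((map unitOption).toLin one) b = (map (Equiv.sumEmpty B Empty).symm).toLin b
  /-- sequential associativity -/
  comp_comp {A B C : Type} [Finite A] [Finite B] [Finite C] (a : obj (Option A))
    (b : obj (Option B)) (c : obj C) :
    comp ((map optionSum).toLin (comp a b)) c =
      (map (Equiv.sumAssoc C B A)).toLin (comp a (comp b c))
  /-- parallel associativity -/
  comp_comm {A B C : Type} [Finite A] [Finite B] [Finite C] (a : obj (Option (Option A)))
    (p q : ℤ) (b : obj B) (hb : b ∈ (obj B).gr p) (c : obj C) (hc : c ∈ (obj C).gr q) :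
    (map sumLeftComm).toLin (comp ((map sumOption).toLin (comp a b)) c) =
      (-1 : k) ^ (p * q) •
        comp ((map sumOption).toLin (comp ((map optionSwap).toLin a) c)) b

/-- Reduced operads: `O(∅) = 0`, and `O(1) = k` through the unit. -/
structure Operad.IsReduced {k : Type u} [Field k] (O : Operad k) : Prop where
  zero : Subsingleton (O.obj Empty)
  one : Function.Bijective (fun c : k => c • O.one)

/-! ### Algebras over an operad -/

section Algebra

variable {k : Type u} [Field k]

/-- The Koszul sign of the reordering, by a permutation `σ`, of homogeneous elements
`y₀, y₁, …` of degrees `q`: every pair `i < j` with `σ j < σ i` contributes `(-1)^(q i * q j)`. -/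
def koszul (k : Type u) [Field k] {n : ℕ} (σ : Equiv.Perm (Fin n)) (q : Fin n → ℤ) : k :=
  ∏ i, ∏ j, if i < j ∧ σ j < σ i then (-1 : k) ^ (q i * q j) else 1

/-- The tuple `((-1)^{|x₀|} x₀, …, (-1)^{|x_{j-1}|} x_{j-1}, y, x_{j+1}, …, x_{n-1})`, which arises
when an operation of odd degree is moved past `x₀, …, x_{j-1}` and applied in position `j`. -/
noncomputable def koszulInsert {n : ℕ} (V : DGMod k) (j : Fin n) (y : V) (x : Fin n → V) :
    Fin n → V :=
  fun i => if i < j then V.sgn (x i) else if i = j then y else x i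

/-- An algebra over `O` in `ℤ`-graded chain complexes. -/
structure UAlg (O : Operad k) where
  mod : DGMod k
  /-- the structure maps `O(n) ⊗ X^{⊗ n} → X` -/
  act (n : ℕ) : O.obj (Fin n) →ₗ[k] MultilinearMap k (fun _ : Fin n => mod.carrier) mod.carrier
  act_mem (n : ℕ) (p : ℤ) (q : Fin n → ℤ) (a : O.obj (Fin n)) (x : Fin n → mod) :
    a ∈ (O.obj (Fin n)).gr p → (∀ i, x i ∈ mod.gr (q i)) → act n a x ∈ mod.gr (p + ∑ i, q i)
  d_act (n : ℕ) (a : O.obj (Fin n)) (x : Fin n → mod) :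
    mod.d (act n a x) = act n ((O.obj (Fin n)).d a) x +
      ∑ j, act n ((O.obj (Fin n)).sgn a) (koszulInsert mod j (mod.d (x j)) x)
  /-- compatibility with the symmetric group actions -/
  act_map (n : ℕ) (σ : Equiv.Perm (Fin n)) (a : O.obj (Fin n)) (q : Fin n → ℤ) (x : Fin n → mod) :
    (∀ i, x i ∈ mod.gr (q i)) →
    act n ((O.map σ).toLin a) x = koszul k σ (fun i => q (σ i)) • act n a (fun i => x (σ i))
  /-- compatibility with the unit -/
  act_one (x : Fin 1 → mod) : act 1 ((O.map (Equiv.ofUnique Unit (Fin 1))).toLin O.one) x = x 0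
  /-- compatibility with composition -/
  act_comp (m n : ℕ) (a : O.obj (Option (Fin m))) (b : O.obj (Fin n)) (x : Fin (n + m) → mod) :
    act (n + m) ((O.map finSumFinEquiv).toLin (O.comp a b)) x =
      act (m + 1) ((O.map (finSuccEquiv m).symm).toLin a)
        (Fin.cons (act n b (fun i => x (Fin.castAdd m i))) (fun i => x (Fin.natAdd n i)))

namespace UAlg

variable {O : Operad k}

/-- Morphisms of algebras. -/
@[ext] structure Hom (X Y : UAlg O) extends DGMod.Hom X.mod Y.mod where
  map_act (n : ℕ) (a : O.obj (Fin n)) (x : Fin n → X.mod) :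
    toLin (X.act n a x) = Y.act n a (fun i => toLin (x i))

/-- The identity. -/
def Hom.id (X : UAlg O) : Hom X X where
  toLin := LinearMap.id
  map_gr _ _ h := h
  map_d _ := rfl
  map_act _ _ _ := rfl

/-- Composition. -/
def Hom.comp {X Y Z : UAlg O} (f : Hom X Y) (g : Hom Y Z) : Hom X Z where
  toLin := g.toLin ∘ₗ f.toLin
  map_gr n x h := g.map_gr n _ (f.map_gr n x h)
  map_d x := by simp [f.map_d, g.map_d]
  map_act n a x := by simp [f.map_act, g.map_act]

end UAlg

end Algebra

/-! ### Extension of scalars of multilinear maps along `k → k[t]` -/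

section PolyExt

open Polynomial

variable {k : Type u} [Field k] {V W : Type u} [AddCommGroup V] [Module k V]
  [AddCommGroup W] [Module k W]

theorem span_tmul :
    Submodule.span k {w : k[X] ⊗[k] V | ∃ (P : k[X]) (x : V), P ⊗ₜ[k] x = w} = ⊤ :=
  TensorProduct.span_tmul_eq_top k k[X] V

theorem multilinear_ext_tmul {n : ℕ} {f g : MultilinearMap k (fun _ : Fin n => k[X] ⊗[k] V) W}
    (h : ∀ (P : Fin n → k[X]) (x : Fin n → V),
      f (fun i => P i ⊗ₜ[k] x i) = g (fun i => P i ⊗ₜ[k] x i)) : f = g := by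
  refine multilinear_ext_of_span span_tmul fun w hw => ?_
  choose P x hPx using hw
  obtain rfl : (fun i => P i ⊗ₜ[k] x i) = w := funext hPx
  exact h P x

theorem exists_polyExt (n : ℕ) (f : MultilinearMap k (fun _ : Fin n => V) W) :
    ∃ g : MultilinearMap k (fun _ : Fin n => k[X] ⊗[k] V) (k[X] ⊗[k] W),
      ∀ (P : Fin n → k[X]) (x : Fin n → V),
        g (fun i => P i ⊗ₜ[k] x i) = (∏ i, P i) ⊗ₜ[k] f x := by
  induction n with
  | zero =>
    refine ⟨MultilinearMap.constOfIsEmpty k _ (1 ⊗ₜ[k] f 0), fun P x => ?_⟩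
    simp [Subsingleton.elim x 0]
  | succ n ih =>
    choose E hE using ih
    have hadd : ∀ g h, E (g + h) = E g + E h := fun g h =>
      multilinear_ext_tmul fun P x => by simp [hE, TensorProduct.tmul_add]
    have hsmul : ∀ (c : k) g, E (c • g) = c • E g := fun c g =>
      multilinear_ext_tmul fun P x => by simp [hE]
    let B : k[X] →ₗ[k] V →ₗ[k] MultilinearMap k (fun _ : Fin n => k[X] ⊗[k] V) (k[X] ⊗[k] W) :=
      LinearMap.mk₂ k (fun P x => P • E (f.curryLeft x))
        (by intros; simp [add_smul]) (by intros; ext; simp [smul_assoc])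
        (by intros; simp [hadd]) (fun c P x => by
          rw [show f.curryLeft (c • x) = c • f.curryLeft x from map_smul _ _ _, hsmul]
          ext w
          exact smul_comm P c _)
    refine ⟨LinearMap.uncurryLeft (TensorProduct.lift B), fun P x => ?_⟩
    have h1 : Fin.tail (fun i => P i ⊗ₜ[k] x i) = fun i => Fin.tail P i ⊗ₜ[k] Fin.tail x i := rfl
    rw [LinearMap.uncurryLeft_apply, TensorProduct.lift.tmul, h1]
    simp only [B, LinearMap.mk₂_apply, _root_.smul_apply, hE, Fin.prod_univ_succ,
      TensorProduct.smul_tmul', smul_eq_mul, MultilinearMap.curryLeft_apply, Fin.cons_self_tail]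
    rfl

/-- The `k[t]`-multilinear extension of a multilinear map `f`: the multilinear map with
`(P₁ ⊗ x₁, …, Pₙ ⊗ xₙ) ↦ (P₁ ⋯ Pₙ) ⊗ f (x₁, …, xₙ)`. -/
noncomputable def polyExt {n : ℕ} (f : MultilinearMap k (fun _ : Fin n => V) W) :
    MultilinearMap k (fun _ : Fin n => k[X] ⊗[k] V) (k[X] ⊗[k] W) :=
  Classical.choose (exists_polyExt n f)

theorem polyExt_tmul {n : ℕ} (f : MultilinearMap k (fun _ : Fin n => V) W)
    (P : Fin n → k[X]) (x : Fin n → V) :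
    polyExt f (fun i => P i ⊗ₜ[k] x i) = (∏ i, P i) ⊗ₜ[k] f x :=
  Classical.choose_spec (exists_polyExt n f) P x

theorem polyExt_add {n : ℕ} (f g : MultilinearMap k (fun _ : Fin n => V) W) :
    polyExt (f + g) = polyExt f + polyExt g := multilinear_ext_tmul fun P x => by
  simp [polyExt_tmul, TensorProduct.tmul_add]

theorem polyExt_smul {n : ℕ} (c : k) (f : MultilinearMap k (fun _ : Fin n => V) W) :
    polyExt (c • f) = c • polyExt f := multilinear_ext_tmul fun P x => by
  simp [polyExt_tmul]

variable (V) in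
/-- Evaluation at `c`: `P ⊗ x ↦ P(c) x`. -/
noncomputable def evalAt (c : k) : k[X] ⊗[k] V →ₗ[k] V :=
  TensorProduct.lift ((LinearMap.lsmul k V).comp (Polynomial.leval c))

@[simp] theorem evalAt_tmul (c : k) (P : k[X]) (x : V) :
    evalAt V c (P ⊗ₜ[k] x) = P.eval c • x := rfl

theorem evalAt_lTensor (c : k) (f : V →ₗ[k] W) (w : k[X] ⊗[k] V) :
    evalAt W c (f.lTensor k[X] w) = f (evalAt V c w) := by
  induction w with
  | zero => simp
  | tmul P x => simp
  | add x y h1 h2 => simp [h1, h2]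

theorem evalAt_ext [CharZero k] {w w' : k[X] ⊗[k] V} (h : ∀ c, evalAt V c w = evalAt V c w') :
    w = w' := by
  classical
  let b := Module.Basis.ofVectorSpace k V
  apply (TensorProduct.equivFinsuppOfBasisRight (M := k[X]) b).injective
  ext1 i
  rw [TensorProduct.equivFinsuppOfBasisRight_apply, TensorProduct.equivFinsuppOfBasisRight_apply]
  have key : ∀ (c : k) (z : k[X] ⊗[k] V),
      (TensorProduct.rid k k[X] ((b.coord i).lTensor k[X] z)).eval c = b.coord i (evalAt V c z) := by
    intro c z
    induction z with
    | zero => simp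
    | tmul P x => simp [mul_comm]
    | add x y h1 h2 => simp only [map_add, Polynomial.eval_add, h1, h2]
  refine Polynomial.funext fun c => ?_
  rw [key, key, h]

theorem evalAt_polyExt (c : k) {n : ℕ} (f : MultilinearMap k (fun _ : Fin n => V) W)
    (w : Fin n → k[X] ⊗[k] V) :
    evalAt W c (polyExt f w) = f (fun i => evalAt V c (w i)) := by
  have : (evalAt W c).compMultilinearMap (polyExt f) =
      f.compLinearMap (fun _ => evalAt V c) := by
    refine multilinear_ext_tmul fun P x => ?_
    simp only [LinearMap.compMultilinearMap_apply, polyExt_tmul, evalAt_tmul,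
      MultilinearMap.compLinearMap_apply, MultilinearMap.map_smul_univ, Polynomial.eval_prod]
  exact congrArg (fun g => g w) this

variable (V) in
/-- The derivation `∂/∂t`: `P ⊗ x ↦ P' ⊗ x`. -/
noncomputable def polyDeriv : k[X] ⊗[k] V →ₗ[k] k[X] ⊗[k] V :=
  (Polynomial.derivative (R := k)).rTensor V

theorem polyDeriv_tmul (P : k[X]) (x : V) :
    polyDeriv V (P ⊗ₜ[k] x) = Polynomial.derivative P ⊗ₜ[k] x := rfl

theorem polyDeriv_lTensor (f : V →ₗ[k] W) (w : k[X] ⊗[k] V) :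
    polyDeriv W (f.lTensor k[X] w) = f.lTensor k[X] (polyDeriv V w) := by
  induction w with
  | zero => simp
  | tmul P x => simp [polyDeriv_tmul]
  | add x y h1 h2 => simp [h1, h2]

theorem polyDeriv_polyExt {n : ℕ} (f : MultilinearMap k (fun _ : Fin n => V) W)
    (w : Fin n → k[X] ⊗[k] V) :
    polyDeriv W (polyExt f w) =
      ∑ j, polyExt f (fun i => if i = j then polyDeriv V (w i) else w i) := by
  have : (polyDeriv W).compMultilinearMap (polyExt f) =
      ∑ j, (polyExt f).compLinearMap
        (fun i => if i = j then polyDeriv V else LinearMap.id) := by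
    refine multilinear_ext_tmul fun P x => ?_
    simp only [LinearMap.compMultilinearMap_apply, polyExt_tmul, polyDeriv_tmul,
      _root_.sum_apply, MultilinearMap.compLinearMap_apply]
    have h : ∀ j, (fun i => (if i = j then polyDeriv V else LinearMap.id) (P i ⊗ₜ[k] x i)) =
        fun i => (if i = j then Polynomial.derivative (P i) else P i) ⊗ₜ[k] x i := by
      intro j; ext i; split_ifs <;> rfl
    simp only [h, polyExt_tmul, ← TensorProduct.sum_tmul]
    congr 1
    rw [Finset.prod_eq_multiset_prod, Polynomial.derivative_prod, Finset.sum_eq_multiset_sum]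
    congr 1
    refine Multiset.map_congr rfl fun j _ => ?_
    have hj := Finset.mul_prod_erase Finset.univ
      (fun i => if i = j then Polynomial.derivative (P i) else P i) (Finset.mem_univ j)
    rw [← hj, mul_comm]
    simp only [if_true]
    congr 1
    rw [← Finset.erase_val, ← Finset.prod_eq_multiset_prod]
    exact Finset.prod_congr rfl fun i hi => by rw [if_neg (Finset.ne_of_mem_erase hi)]
  have h2 := congrArg (fun g => g w) this
  simp only [LinearMap.compMultilinearMap_apply, _root_.sum_apply,
    MultilinearMap.compLinearMap_apply] at h2
  rw [h2]
  refine Finset.sum_congr rfl fun j _ => congrArg _ (funext fun i => ?_)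
  split_ifs <;> rfl

end PolyExt

/-! ### The algebra `k[t] ⊗ X` -/

section PolyAlg

open Polynomial

variable {k : Type u} [Field k]

theorem DGMod.lTensor_of_mem {V : DGMod k}
    {M : Submodule k V} {W : Type u} [AddCommGroup W] [Module k W] {f g : V →ₗ[k] W}
    (h : ∀ x ∈ M, f x = g x) {w : k[X] ⊗[k] V}
    (hw : w ∈ LinearMap.range (M.subtype.lTensor k[X])) :
    f.lTensor k[X] w = g.lTensor k[X] w := by
  obtain ⟨z, rfl⟩ := hw
  rw [← LinearMap.comp_apply, ← LinearMap.comp_apply, ← LinearMap.lTensor_comp,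
    ← LinearMap.lTensor_comp]
  congr 2
  ext x
  exact h x x.2

/-- The complex `k[t] ⊗ V`, with `t` of degree `0` and `d (P ⊗ x) = P ⊗ d x`. -/
noncomputable def DGMod.poly (V : DGMod k) : DGMod k where
  carrier := k[X] ⊗[k] V
  gr n := LinearMap.range ((V.gr n).subtype.lTensor k[X])
  isInternal := by
    refine isInternal_of_proj _ (fun n => (V.proj n).lTensor k[X]) ?_ ?_ ?_
    · intro n w hw
      rw [DGMod.lTensor_of_mem (g := LinearMap.id) (fun x hx => V.proj_of_mem hx) hw]
      simp
    · intro m n w hmn hw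
      rw [DGMod.lTensor_of_mem (g := 0) (fun x hx => V.proj_of_mem_ne hmn hx) hw]
      simp
    · rw [eq_top_iff]
      rintro w -
      induction w with
      | zero => exact Submodule.zero_mem _
      | tmul P x =>
        induction x using DGMod.induction_gr with
        | h n x hx => exact Submodule.mem_iSup_of_mem n ⟨P ⊗ₜ ⟨x, hx⟩, rfl⟩
        | hadd x y h1 h2 => rw [TensorProduct.tmul_add]; exact Submodule.add_mem _ h1 h2
      | add x y h1 h2 => exact Submodule.add_mem _ h1 h2
  d := V.d.lTensor k[X]
  d_mem := by
    rintro n _ ⟨z, rfl⟩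
    refine ⟨(V.d.restrict (V.d_mem n)).lTensor k[X] z, ?_⟩
    rw [← LinearMap.comp_apply, ← LinearMap.comp_apply, ← LinearMap.lTensor_comp,
      ← LinearMap.lTensor_comp]
    rfl
  d_d w := by
    rw [← LinearMap.comp_apply, ← LinearMap.lTensor_comp,
      show V.d ∘ₗ V.d = 0 from LinearMap.ext V.d_d]
    simp

theorem DGMod.evalAt_mem (V : DGMod k) (c : k) {n : ℤ} {w : V.poly} (hw : w ∈ V.poly.gr n) :
    evalAt V c w ∈ V.gr n := by
  obtain ⟨z, rfl⟩ := hw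
  rw [evalAt_lTensor]
  exact SetLike.coe_mem _

/-- Evaluation at `c` as a morphism of complexes. -/
noncomputable def DGMod.evalHom (V : DGMod k) (c : k) : DGMod.Hom V.poly V where
  toLin := evalAt V c
  map_gr _ _ hw := V.evalAt_mem c hw
  map_d w := evalAt_lTensor c V.d w

theorem DGMod.evalHom_ext [CharZero k] {V : DGMod k} {w w' : V.poly}
    (h : ∀ c, (V.evalHom c).toLin w = (V.evalHom c).toLin w') : w = w' :=
  evalAt_ext h

theorem DGMod.mem_poly_of_evalHom [CharZero k] (V : DGMod k) {n : ℤ} {w : V.poly}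
    (h : ∀ c, (V.evalHom c).toLin w ∈ V.gr n) : w ∈ V.poly.gr n := by
  have : V.poly.proj n w = w := DGMod.evalHom_ext fun c =>
    ((V.evalHom c).map_proj n w).trans (DGMod.proj_of_mem (h c))
  rw [← this]
  exact DGMod.proj_mem n w

theorem DGMod.Hom.map_koszulInsert {V W : DGMod k} (f : DGMod.Hom V W) {n : ℕ} (j : Fin n) (y : V)
    (x : Fin n → V) (i : Fin n) :
    f.toLin (koszulInsert V j y x i) =
      koszulInsert W j (f.toLin y) (fun i => f.toLin (x i)) i := by
  unfold koszulInsert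
  split_ifs
  · rw [f.map_sgn]
  · rfl
  · rfl

/-- `∂/∂t` on `k[t] ⊗ V`. -/
noncomputable def DGMod.deriv (V : DGMod k) : V.poly →ₗ[k] V.poly := polyDeriv V

theorem DGMod.deriv_mem (V : DGMod k) {n : ℤ} {w : V.poly} (hw : w ∈ V.poly.gr n) :
    V.deriv w ∈ V.poly.gr n := by
  obtain ⟨z, rfl⟩ := hw
  exact ⟨_, (polyDeriv_lTensor _ _).symm⟩

theorem DGMod.deriv_d (V : DGMod k) (w : V.poly) : V.deriv (V.poly.d w) = V.poly.d (V.deriv w) :=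
  polyDeriv_lTensor _ _

theorem DGMod.deriv_sgn (V : DGMod k) (w : V.poly) :
    V.deriv (V.poly.sgn w) = V.poly.sgn (V.deriv w) := by
  induction w using DGMod.induction_gr with
  | h n w hw => rw [DGMod.sgn_of_mem hw, DGMod.sgn_of_mem (V.deriv_mem hw), map_smul]
  | hadd x y h1 h2 => simp only [map_add, h1, h2]

variable {O : Operad k}

/-- The structure maps of `k[t] ⊗ X`. -/
noncomputable def UAlg.polyAct (X : UAlg O) (n : ℕ) : O.obj (Fin n) →ₗ[k]
    MultilinearMap k (fun _ : Fin n => X.mod.poly.carrier) X.mod.poly.carrier where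
  toFun a := polyExt (X.act n a)
  map_add' a b := by rw [map_add]; exact polyExt_add _ _
  map_smul' c a := by rw [map_smul]; exact polyExt_smul _ _

theorem UAlg.evalHom_polyAct (X : UAlg O) (c : k) (n : ℕ) (a : O.obj (Fin n))
    (w : Fin n → X.mod.poly) :
    (X.mod.evalHom c).toLin (X.polyAct n a w) =
      X.act n a (fun i => (X.mod.evalHom c).toLin (w i)) :=
  evalAt_polyExt c (X.act n a) w

theorem UAlg.deriv_polyAct (X : UAlg O) (n : ℕ) (a : O.obj (Fin n)) (w : Fin n → X.mod.poly) :
    X.mod.deriv (X.polyAct n a w) =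
      ∑ j, X.polyAct n a (fun i => if i = j then X.mod.deriv (w i) else w i) :=
  polyDeriv_polyExt (X.act n a) w

/-- The algebra `k[t] ⊗ X`, with
`m (a; P₁ ⊗ x₁, …, Pₙ ⊗ xₙ) = (P₁ ⋯ Pₙ) ⊗ m (a; x₁, …, xₙ)`. -/
noncomputable def UAlg.poly [CharZero k] (X : UAlg O) : UAlg O where
  mod := X.mod.poly
  act := X.polyAct
  act_mem n p q a x ha hx := DGMod.mem_poly_of_evalHom _ fun c => by
    rw [X.evalHom_polyAct]
    exact X.act_mem n p q a _ ha fun i => (X.mod.evalHom c).map_gr _ _ (hx i)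
  d_act n a x := DGMod.evalHom_ext fun c => by
    simp only [DGMod.Hom.map_d, map_add, map_sum, X.evalHom_polyAct, DGMod.Hom.map_koszulInsert]
    exact X.d_act n a _
  act_map n σ a q x hx := DGMod.evalHom_ext fun c => by
    simp only [map_smul, X.evalHom_polyAct]
    exact X.act_map n σ a q _ fun i => (X.mod.evalHom c).map_gr _ _ (hx i)
  act_one x := DGMod.evalHom_ext fun c => by
    rw [X.evalHom_polyAct]
    exact X.act_one _
  act_comp m n a b x := DGMod.evalHom_ext fun c => by
    rw [X.evalHom_polyAct, X.evalHom_polyAct, X.act_comp]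
    congr 1
    ext i
    refine Fin.cases ?_ (fun i => ?_) i
    · simp [X.evalHom_polyAct]
    · simp

end PolyAlg

/-! ### Adjoining `dt` -/

section Dt

variable {k : Type u} [Field k]

/-- A linear map of degree `0` commuting with the differential. -/
structure DGMod.Endo (V : DGMod k) where
  D : V →ₗ[k] V
  mem : ∀ (n : ℤ) (x : V), x ∈ V.gr n → D x ∈ V.gr n
  comm : ∀ x, D (V.d x) = V.d (D x)

/-- The complex `V ⊕ dt V`, where `dt` has degree `-1`: the pair `(u, v)` stands for `u + dt v`,
and `d (u + dt v) = d u + dt (D u - d v)`. -/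
noncomputable def DGMod.dt (V : DGMod k) (δ : V.Endo) : DGMod k where
  carrier := V × V
  gr n := (V.gr n).prod (V.gr (n + 1))
  isInternal := by
    refine isInternal_of_proj _ (fun n => (V.proj n).prodMap (V.proj (n + 1))) ?_ ?_ ?_
    · rintro n ⟨x, y⟩ ⟨hx, hy⟩
      exact Prod.ext (DGMod.proj_of_mem hx) (DGMod.proj_of_mem hy)
    · rintro m n ⟨x, y⟩ hmn ⟨hx, hy⟩
      exact Prod.ext (DGMod.proj_of_mem_ne hmn hx)
        (DGMod.proj_of_mem_ne (fun h => hmn (by omega)) hy)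
    · rw [eq_top_iff]
      rintro ⟨x, y⟩ -
      have h : (x, y) = (x, 0) + (0, y) := by simp
      rw [h]
      refine Submodule.add_mem _ ?_ ?_
      · induction x using DGMod.induction_gr with
        | h n x hx => exact Submodule.mem_iSup_of_mem n ⟨hx, Submodule.zero_mem _⟩
        | hadd x y h1 h2 =>
          have : ((x + y, 0) : V × V) = (x, 0) + (y, 0) := by simp
          rw [this]; exact Submodule.add_mem _ (h1 (by simp)) (h2 (by simp))
      · induction y using DGMod.induction_gr with
        | h n x hx => exact Submodule.mem_iSup_of_mem (n - 1) ⟨Submodule.zero_mem _, by simpa using hx⟩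
        | hadd x y h1 h2 =>
          have : ((0, x + y) : V × V) = (0, x) + (0, y) := by simp
          rw [this]; exact Submodule.add_mem _ (h1 (by simp)) (h2 (by simp))
  d := (V.d ∘ₗ LinearMap.fst k V V).prod (δ.D ∘ₗ LinearMap.fst k V V - V.d ∘ₗ LinearMap.snd k V V)
  d_mem := by
    rintro n ⟨x, y⟩ ⟨hx, hy⟩
    exact ⟨V.d_mem n x hx, Submodule.sub_mem _ (δ.mem _ _ hx) (V.d_mem _ y hy)⟩
  d_d := by
    rintro ⟨x, y⟩
    refine Prod.ext (V.d_d x) ?_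
    simp [δ.comm, V.d_d]

namespace DGMod

variable (V : DGMod k) (δ : V.Endo)

/-- `u + dt v ↦ u`. -/
def dtFst : V.dt δ →ₗ[k] V := LinearMap.fst k V V

/-- `u + dt v ↦ v`. -/
def dtSnd : V.dt δ →ₗ[k] V := LinearMap.snd k V V

/-- `u ↦ u`. -/
def dtInl : V →ₗ[k] V.dt δ := LinearMap.inl k V V

/-- `v ↦ dt v`. -/
def dtInr : V →ₗ[k] V.dt δ := LinearMap.inr k V V

variable {V δ}

theorem dt_ext {x y : V.dt δ} (h1 : V.dtFst δ x = V.dtFst δ y) (h2 : V.dtSnd δ x = V.dtSnd δ y) :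
    x = y := Prod.ext h1 h2

@[simp] theorem dtFst_dtInl (x : V) : V.dtFst δ (V.dtInl δ x) = x := rfl
@[simp] theorem dtSnd_dtInl (x : V) : V.dtSnd δ (V.dtInl δ x) = 0 := rfl
@[simp] theorem dtFst_dtInr (x : V) : V.dtFst δ (V.dtInr δ x) = 0 := rfl
@[simp] theorem dtSnd_dtInr (x : V) : V.dtSnd δ (V.dtInr δ x) = x := rfl

theorem mem_dt_gr {n : ℤ} {x : V.dt δ} :
    x ∈ (V.dt δ).gr n ↔ V.dtFst δ x ∈ V.gr n ∧ V.dtSnd δ x ∈ V.gr (n + 1) := Iff.rfl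

@[simp] theorem dtFst_d (x : V.dt δ) : V.dtFst δ ((V.dt δ).d x) = V.d (V.dtFst δ x) := rfl

@[simp] theorem dtSnd_d (x : V.dt δ) :
    V.dtSnd δ ((V.dt δ).d x) = δ.D (V.dtFst δ x) - V.d (V.dtSnd δ x) := rfl

@[simp] theorem dtFst_sgn (x : V.dt δ) : V.dtFst δ ((V.dt δ).sgn x) = V.sgn (V.dtFst δ x) := by
  induction x using DGMod.induction_gr with
  | h n w hw => rw [sgn_of_mem hw, map_smul, sgn_of_mem (mem_dt_gr.1 hw).1]
  | hadd x y h1 h2 => simp only [map_add, h1, h2]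

@[simp] theorem dtSnd_sgn (x : V.dt δ) : V.dtSnd δ ((V.dt δ).sgn x) = -V.sgn (V.dtSnd δ x) := by
  induction x using DGMod.induction_gr with
  | h n w hw =>
    rw [sgn_of_mem hw, map_smul, sgn_of_mem (mem_dt_gr.1 hw).2, zpow_add₀ (by simp)]
    simp
  | hadd x y h1 h2 => simp only [map_add, h1, h2, neg_add]

end DGMod

/-- A degree `0` derivation of an algebra commuting with the differential. -/
structure UAlg.Der {O : Operad k} (A : UAlg O) extends A.mod.Endo where
  leibniz (n : ℕ) (a : O.obj (Fin n)) (x : Fin n → A.mod) :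
    D (A.act n a x) = ∑ j, A.act n a (fun i => if i = j then D (x i) else x i)

namespace UAlg

variable {O : Operad k} (A : UAlg O) (δ : A.Der)

/-- The structure maps of `A ⊕ dt A`: the sum of all terms of
`m (a; u₀ + dt v₀, …)` with at most one factor `dt`, this factor being moved to the left past
`a, u₀, …, u_{j-1}` with the Koszul sign; the other terms vanish since `dt² = 0`. -/
noncomputable def dtAct (n : ℕ) : O.obj (Fin n) →ₗ[k]
    MultilinearMap k (fun _ : Fin n => (A.mod.dt δ.toEndo).carrier) (A.mod.dt δ.toEndo).carrier where
  toFun a :=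
    (A.mod.dtInl δ.toEndo).compMultilinearMap
      ((A.act n a).compLinearMap (fun _ => A.mod.dtFst δ.toEndo)) +
    (A.mod.dtInr δ.toEndo).compMultilinearMap
      (∑ j, (A.act n ((O.obj (Fin n)).sgn a)).compLinearMap (fun i =>
        if i < j then A.mod.sgn ∘ₗ A.mod.dtFst δ.toEndo
        else if i = j then A.mod.dtSnd δ.toEndo else A.mod.dtFst δ.toEndo))
  map_add' a b := by
    refine MultilinearMap.ext fun x => DGMod.dt_ext ?_ ?_
    · simp
    · simp [Finset.sum_add_distrib]
  map_smul' c a := by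
    refine MultilinearMap.ext fun x => DGMod.dt_ext ?_ ?_
    · simp
    · simp [Finset.smul_sum]

@[simp] theorem dtFst_dtAct (n : ℕ) (a : O.obj (Fin n)) (x : Fin n → A.mod.dt δ.toEndo) :
    A.mod.dtFst δ.toEndo (A.dtAct δ n a x) =
      A.act n a (fun i => A.mod.dtFst δ.toEndo (x i)) := by
  simp [dtAct]

theorem dtSnd_dtAct (n : ℕ) (a : O.obj (Fin n)) (x : Fin n → A.mod.dt δ.toEndo) :
    A.mod.dtSnd δ.toEndo (A.dtAct δ n a x) =
      ∑ j, A.act n ((O.obj (Fin n)).sgn a) (koszulInsert A.mod j (A.mod.dtSnd δ.toEndo (x j))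
        (fun i => A.mod.dtFst δ.toEndo (x i))) := by
  simp only [dtAct, LinearMap.coe_mk, AddHom.coe_mk, _root_.add_apply, map_add,
    LinearMap.compMultilinearMap_apply, DGMod.dtSnd_dtInl, DGMod.dtSnd_dtInr, zero_add]
  rw [_root_.sum_apply]
  refine Finset.sum_congr rfl fun j _ => ?_
  rw [MultilinearMap.compLinearMap_apply]
  congr 1
  ext i
  unfold koszulInsert
  split_ifs with h1 h2
  · rfl
  · subst h2; rfl
  · rfl

variable {A}

theorem sgn_act (n : ℕ) (a : O.obj (Fin n)) (x : Fin n → A.mod) :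
    A.mod.sgn (A.act n a x) = A.act n ((O.obj (Fin n)).sgn a) (fun i => A.mod.sgn (x i)) := by
  induction a using DGMod.induction_gr with
  | hadd a b h1 h2 => simp only [map_add, _root_.add_apply, h1, h2]
  | h p a ha =>
    have : A.mod.sgn.compMultilinearMap (A.act n a) =
        (A.act n ((O.obj (Fin n)).sgn a)).compLinearMap (fun _ => A.mod.sgn) := by
      refine DGMod.multilinear_ext_gr fun q x hx => ?_
      simp only [LinearMap.compMultilinearMap_apply, MultilinearMap.compLinearMap_apply]
      rw [DGMod.sgn_of_mem (A.act_mem n p q a x ha hx), DGMod.sgn_of_mem ha]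
      have h : (fun i => A.mod.sgn (x i)) = fun i => (-1 : k) ^ q i • x i :=
        funext fun i => DGMod.sgn_of_mem (hx i)
      rw [h, MultilinearMap.map_smul_univ, map_smul, _root_.smul_apply, smul_smul]
      congr 1
      rw [zpow_add₀ (by simp), mul_comm]
      congr 1
      induction (Finset.univ : Finset (Fin n)) using Finset.induction_on with
      | empty => simp
      | insert i s hi ih => rw [Finset.sum_insert hi, Finset.prod_insert hi, zpow_add₀ (by simp), ih]
    exact congrArg (fun g => g x) this

theorem act_update_neg (n : ℕ) (a : O.obj (Fin n)) (x y : Fin n → A.mod) (i : Fin n)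
    (hi : y i = -x i) (h : ∀ l, l ≠ i → y l = x l) : A.act n a y = -A.act n a x := by
  have hy : y = Function.update x i (-x i) := by
    ext l
    by_cases hl : l = i
    · subst hl; simpa using hi
    · rw [Function.update_of_ne hl, h l hl]
  rw [hy, MultilinearMap.map_update_neg, Function.update_eq_self]

theorem dt_d_act (n : ℕ) (a : O.obj (Fin n)) (x : Fin n → A.mod.dt δ.toEndo) :
    (A.mod.dt δ.toEndo).d (A.dtAct δ n a x) = A.dtAct δ n ((O.obj (Fin n)).d a) x +
      ∑ j, A.dtAct δ n ((O.obj (Fin n)).sgn a)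
        (koszulInsert (A.mod.dt δ.toEndo) j ((A.mod.dt δ.toEndo).d (x j)) x) := by
  have hins : ∀ (j l : Fin n) y, koszulInsert (A.mod.dt δ.toEndo) j y x l =
      (if l < j then (A.mod.dt δ.toEndo).sgn (x l) else if l = j then y else x l) :=
    fun _ _ _ => rfl
  refine DGMod.dt_ext ?_ ?_
  · rw [DGMod.dtFst_d, dtFst_dtAct, A.d_act, map_add, map_sum, dtFst_dtAct]
    congr 1
    refine Finset.sum_congr rfl fun j _ => ?_
    rw [dtFst_dtAct]
    congr 1
    ext l
    rw [hins]
    unfold koszulInsert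
    split_ifs <;> simp
  · simp only [DGMod.dtSnd_d, dtFst_dtAct, dtSnd_dtAct, map_add, map_sum]
    rw [δ.leibniz]
    obtain ⟨u, hu⟩ : ∃ u : Fin n → A.mod, ∀ l, A.mod.dtFst δ.toEndo (x l) = u l :=
      ⟨_, fun _ => rfl⟩
    obtain ⟨v, hv⟩ : ∃ v : Fin n → A.mod, ∀ l, A.mod.dtSnd δ.toEndo (x l) = v l :=
      ⟨_, fun _ => rfl⟩
    have key : ∀ i j, A.act n a (koszulInsert A.mod j (A.mod.dtSnd δ.toEndo
          (koszulInsert (A.mod.dt δ.toEndo) i ((A.mod.dt δ.toEndo).d (x i)) x j))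
          (fun l => A.mod.dtFst δ.toEndo
            (koszulInsert (A.mod.dt δ.toEndo) i ((A.mod.dt δ.toEndo).d (x i)) x l))) =
        (if j = i then A.act n a (fun l => if l = i then δ.D (u l) else u l) else 0) -
          A.act n a (koszulInsert A.mod i (A.mod.d (koszulInsert A.mod j (v j) u i))
            (koszulInsert A.mod j (v j) u)) := by
      intro i j
      by_cases hji : j = i
      · subst hji
        rw [if_pos rfl]
        have hT : (koszulInsert A.mod j (A.mod.dtSnd δ.toEndo
            (koszulInsert (A.mod.dt δ.toEndo) j ((A.mod.dt δ.toEndo).d (x j)) x j))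
            (fun l => A.mod.dtFst δ.toEndo
              (koszulInsert (A.mod.dt δ.toEndo) j ((A.mod.dt δ.toEndo).d (x j)) x l))) =
            Function.update u j (δ.D (u j) - A.mod.d (v j)) := by
          ext l
          simp only [koszulInsert.eq_def A.mod, hins]
          rcases lt_trichotomy l j with h | h | h
          · simp [h, h.ne, hu]
          · subst h; simp [hu, hv]
          · simp [h.not_gt, h.ne', hu]
        have hS : (koszulInsert A.mod j (A.mod.d (koszulInsert A.mod j (v j) u j))
            (koszulInsert A.mod j (v j) u)) = Function.update u j (A.mod.d (v j)) := by
          ext l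
          simp only [koszulInsert]
          rcases lt_trichotomy l j with h | h | h
          · simp [h, h.ne]
          · subst h; simp
          · simp [h.not_gt, h.ne']
        have hL : (fun l => if l = j then δ.D (u l) else u l) =
            Function.update u j (δ.D (u j)) := by
          ext l
          by_cases h : l = j
          · subst h; simp
          · simp [h]
        rw [hT, hS, hL, MultilinearMap.map_update_sub]
      · rw [if_neg hji, zero_sub]
        rcases lt_or_gt_of_ne hji with hlt | hlt
        · refine act_update_neg n a _ _ j ?_ fun l hl => ?_
          · simp [koszulInsert.eq_def A.mod, hins, hlt, hv]
          · simp only [koszulInsert.eq_def A.mod, hins]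
            rcases lt_trichotomy l j with h | h | h
            · simp [h, h.trans hlt, hu]
            · exact absurd h hl
            · rcases lt_trichotomy l i with h' | h' | h'
              · simp [h.not_gt, h.ne', h', hu]
              · subst h'; simp [h.not_gt, h.ne', hu]
              · simp [h.not_gt, h.ne', h'.not_gt, h'.ne', hu]
        · refine act_update_neg n a _ _ i ?_ fun l hl => ?_
          · simp [koszulInsert.eq_def A.mod, hins, hlt, hu, DGMod.d_sgn]
          · simp only [koszulInsert.eq_def A.mod, hins]
            rcases lt_trichotomy l i with h | h | h
            · simp [h, h.trans hlt, hu]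
            · exact absurd h hl
            · rcases lt_trichotomy l j with h' | h' | h'
              · simp [h.not_gt, h.ne', h', hu]
              · subst h'; simp [h.not_gt, h.ne', hv]
              · simp [h.not_gt, h.ne', h'.not_gt, h'.ne', hu]
    simp only [A.d_act, DGMod.sgn_sgn, DGMod.d_sgn, map_neg, _root_.neg_apply, key, hu, hv]
    simp only [Finset.sum_add_distrib, Finset.sum_sub_distrib, Finset.sum_neg_distrib,
      Finset.sum_ite_eq', Finset.mem_univ, if_true]
    rw [Finset.sum_comm (f := fun i j => A.act n a
      (koszulInsert A.mod i (A.mod.d (koszulInsert A.mod j (v j) u i))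
        (koszulInsert A.mod j (v j) u)))]
    abel

theorem koszulInsert_mem {V : DGMod k} {n : ℕ} (q : Fin n → ℤ) (j : Fin n) {y : V}
    {x : Fin n → V} (hy : y ∈ V.gr (q j + 1)) (hx : ∀ i, x i ∈ V.gr (q i)) (i : Fin n) :
    koszulInsert V j y x i ∈ V.gr (q i + if i = j then 1 else 0) := by
  unfold koszulInsert
  rcases lt_trichotomy i j with h | h | h
  · simpa [h, h.ne] using DGMod.sgn_mem (hx i)
  · subst h; simpa using hy
  · simpa [h.not_gt, h.ne'] using hx i

theorem dt_act_mem (n : ℕ) (p : ℤ) (q : Fin n → ℤ) (a : O.obj (Fin n))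
    (x : Fin n → A.mod.dt δ.toEndo) (ha : a ∈ (O.obj (Fin n)).gr p)
    (hx : ∀ i, x i ∈ (A.mod.dt δ.toEndo).gr (q i)) :
    A.dtAct δ n a x ∈ (A.mod.dt δ.toEndo).gr (p + ∑ i, q i) := by
  rw [DGMod.mem_dt_gr, dtFst_dtAct, dtSnd_dtAct]
  refine ⟨A.act_mem n p q a _ ha fun i => (DGMod.mem_dt_gr.1 (hx i)).1,
    Submodule.sum_mem _ fun j _ => ?_⟩
  have := A.act_mem n p _ _ _ (DGMod.sgn_mem ha)
    (koszulInsert_mem q j (DGMod.mem_dt_gr.1 (hx j)).2 fun i => (DGMod.mem_dt_gr.1 (hx i)).1)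
  rwa [Finset.sum_add_distrib, Finset.sum_ite_eq', if_pos (Finset.mem_univ j), ← add_assoc] at this

theorem koszul_add_single {n : ℕ} (σ : Equiv.Perm (Fin n)) (q : Fin n → ℤ) (j : Fin n) :
    koszul k σ (fun i => q i + if i = j then 1 else 0) =
      koszul k σ q * ∏ i, if (i < j ∧ σ j < σ i) ∨ (j < i ∧ σ i < σ j) then (-1 : k) ^ q i else 1 := by
  have h : ∀ i l, (if i < l ∧ σ l < σ i then
      (-1 : k) ^ ((q i + if i = j then 1 else 0) * (q l + if l = j then 1 else 0)) else 1) =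
      (if i < l ∧ σ l < σ i then (-1 : k) ^ (q i * q l) else 1) *
      ((if l = j then (if i < j ∧ σ j < σ i then (-1 : k) ^ q i else 1) else 1) *
        (if i = j then (if j < l ∧ σ l < σ j then (-1 : k) ^ q l else 1) else 1)) := by
    intro i l
    by_cases hl : l = j
    · subst hl
      by_cases hi : i = l
      · subst hi; simp
      · by_cases hc : i < l ∧ σ l < σ i
        · simp [hi, hc, mul_add, zpow_add₀]
        · simp [hi, hc]
    · by_cases hi : i = j
      · subst hi
        by_cases hc : i < l ∧ σ l < σ i
        · simp [hl, hc, add_mul, zpow_add₀]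
        · simp [hl, hc]
      · simp [hl, hi]
  unfold koszul
  simp only [h, Finset.prod_mul_distrib]
  congr 1
  rw [Finset.prod_comm (f := fun i l => if i = j then
    (if j < l ∧ σ l < σ j then (-1 : k) ^ q l else 1) else 1)]
  simp only [Finset.prod_ite_eq', Finset.mem_univ, if_true]
  rw [← Finset.prod_mul_distrib]
  refine Finset.prod_congr rfl fun i _ => ?_
  rcases lt_trichotomy i j with h1 | h1 | h1
  · simp [h1, h1.not_gt]
  · subst h1; simp
  · simp [h1, h1.not_gt]

theorem act_koszulInsert_map (n : ℕ) (σ : Equiv.Perm (Fin n)) (a : O.obj (Fin n)) (q : Fin n → ℤ)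
    (u : Fin n → A.mod) (hu : ∀ i, u i ∈ A.mod.gr (q i)) (j : Fin n) (v : A.mod)
    (hv : v ∈ A.mod.gr (q (σ j) + 1)) :
    A.act n ((O.map σ).toLin a) (koszulInsert A.mod (σ j) v u) =
      koszul k σ (fun i => q (σ i)) •
        A.act n a (koszulInsert A.mod j v (fun i => u (σ i))) := by
  rw [A.act_map n σ a _ _ (koszulInsert_mem q (σ j) hv hu)]
  have h1 : (fun i => q (σ i) + if σ i = σ j then (1 : ℤ) else 0) =
      fun i => q (σ i) + if i = j then 1 else 0 := by simp
  rw [h1, koszul_add_single σ (fun i => q (σ i)) j, mul_smul]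
  congr 1
  let z : Fin n → A.mod := fun i => if i = j then v else u (σ i)
  have hz1 : (fun i => koszulInsert A.mod (σ j) v u (σ i)) =
      fun i => (if σ i < σ j then (-1 : k) ^ q (σ i) else 1) • z i := by
    ext i
    by_cases hij : i = j
    · subst hij; simp [koszulInsert, z]
    · by_cases h : σ i < σ j
      · simp [koszulInsert, z, hij, h, DGMod.sgn_of_mem (hu (σ i))]
      · simp [koszulInsert, z, hij, h]
  have hz2 : koszulInsert A.mod j v (fun i => u (σ i)) =
      fun i => (if i < j then (-1 : k) ^ q (σ i) else 1) • z i := by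
    ext i
    by_cases hij : i = j
    · subst hij; simp [koszulInsert, z]
    · by_cases h : i < j
      · simp [koszulInsert, z, hij, h, DGMod.sgn_of_mem (hu (σ i))]
      · simp [koszulInsert, z, hij, h]
  rw [hz1, hz2, MultilinearMap.map_smul_univ, MultilinearMap.map_smul_univ, smul_smul,
    ← Finset.prod_mul_distrib]
  congr 1
  refine Finset.prod_congr rfl fun i _ => ?_
  have hne : i ≠ j → σ i ≠ σ j := fun h h' => h (σ.injective h')
  rcases lt_trichotomy i j with h1 | h1 | h1
  · rcases lt_or_gt_of_ne (hne h1.ne) with h2 | h2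
    · simp [h1, h2, h1.not_gt, h2.not_gt]
    · simp [h1, h2, h1.not_gt, h2.not_gt]
  · subst h1; simp
  · rcases lt_or_gt_of_ne (hne h1.ne') with h2 | h2
    · simp [h1, h2, h1.not_gt, h2.not_gt, DGMod.neg_one_zpow_mul_self]
    · simp [h1, h2, h1.not_gt, h2.not_gt]

theorem dt_act_map (n : ℕ) (σ : Equiv.Perm (Fin n)) (a : O.obj (Fin n)) (q : Fin n → ℤ)
    (x : Fin n → A.mod.dt δ.toEndo) (hx : ∀ i, x i ∈ (A.mod.dt δ.toEndo).gr (q i)) :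
    A.dtAct δ n ((O.map σ).toLin a) x =
      koszul k σ (fun i => q (σ i)) • A.dtAct δ n a (fun i => x (σ i)) := by
  refine DGMod.dt_ext ?_ ?_
  · rw [map_smul, dtFst_dtAct, dtFst_dtAct]
    exact A.act_map n σ a q _ fun i => (DGMod.mem_dt_gr.1 (hx i)).1
  · rw [map_smul, dtSnd_dtAct, dtSnd_dtAct, Finset.smul_sum, ← Equiv.sum_comp σ]
    refine Finset.sum_congr rfl fun j _ => ?_
    rw [← DGMod.Hom.map_sgn]
    exact act_koszulInsert_map n σ _ q _ (fun i => (DGMod.mem_dt_gr.1 (hx i)).1) j _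
      (DGMod.mem_dt_gr.1 (hx (σ j))).2

theorem sgn_comp {B C : Type} [Finite B] [Finite C] (a : O.obj (Option B)) (b : O.obj C) :
    (O.obj (C ⊕ B)).sgn (O.comp a b) =
      O.comp ((O.obj (Option B)).sgn a) ((O.obj C).sgn b) := by
  induction a using DGMod.induction_gr with
  | hadd x y h1 h2 => simp only [map_add, LinearMap.add_apply, h1, h2]
  | h p a ha =>
    induction b using DGMod.induction_gr with
    | hadd x y h1 h2 => simp only [map_add, h1, h2]
    | h q b hb =>
      rw [DGMod.sgn_of_mem ha, DGMod.sgn_of_mem hb, DGMod.sgn_of_mem (O.comp_mem p q a b ha hb)]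
      simp [zpow_add₀, smul_smul, mul_comm]

theorem dt_act_one (x : Fin 1 → A.mod.dt δ.toEndo) :
    A.dtAct δ 1 ((O.map (Equiv.ofUnique Unit (Fin 1))).toLin O.one) x = x 0 := by
  refine DGMod.dt_ext ?_ ?_
  · rw [dtFst_dtAct, A.act_one]
  · rw [dtSnd_dtAct, ← DGMod.Hom.map_sgn, DGMod.sgn_of_mem O.one_mem, zpow_zero, one_smul,
      Fin.sum_univ_one, A.act_one]
    simp [koszulInsert]

theorem dt_act_comp (m n : ℕ) (a : O.obj (Option (Fin m))) (b : O.obj (Fin n))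
    (x : Fin (n + m) → A.mod.dt δ.toEndo) :
    A.dtAct δ (n + m) ((O.map finSumFinEquiv).toLin (O.comp a b)) x =
      A.dtAct δ (m + 1) ((O.map (finSuccEquiv m).symm).toLin a)
        (Fin.cons (A.dtAct δ n b (fun i => x (Fin.castAdd m i))) (fun i => x (Fin.natAdd n i))) := by
  have hfst : (fun i => A.mod.dtFst δ.toEndo ((Fin.cons (A.dtAct δ n b (fun i => x (Fin.castAdd m i)))
      (fun i => x (Fin.natAdd n i)) : Fin (m + 1) → A.mod.dt δ.toEndo) i)) =
      Fin.cons (A.act n b (fun i => A.mod.dtFst δ.toEndo (x (Fin.castAdd m i))))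
        (fun i => A.mod.dtFst δ.toEndo (x (Fin.natAdd n i))) := by
    ext i
    refine Fin.cases ?_ (fun i => ?_) i
    · simp
    · simp
  refine DGMod.dt_ext ?_ ?_
  · rw [dtFst_dtAct, dtFst_dtAct, A.act_comp, hfst]
  · rw [dtSnd_dtAct, dtSnd_dtAct, hfst, ← DGMod.Hom.map_sgn, ← DGMod.Hom.map_sgn, sgn_comp,
      Fin.sum_univ_add, Fin.sum_univ_succ]
    simp only [A.act_comp, Fin.cons_zero, Fin.cons_succ]
    congr 1
    · rw [dtSnd_dtAct]
      have h0 : ∀ z, koszulInsert A.mod (0 : Fin (m + 1)) z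
          (Fin.cons (A.act n b (fun i => A.mod.dtFst δ.toEndo (x (Fin.castAdd m i))))
            (fun i => A.mod.dtFst δ.toEndo (x (Fin.natAdd n i)))) =
          Function.update (Fin.cons 0 (fun i => A.mod.dtFst δ.toEndo (x (Fin.natAdd n i)))) 0 z := by
        intro z
        ext i
        refine Fin.cases ?_ (fun i => ?_) i
        · simp [koszulInsert]
        · simp [koszulInsert]
      rw [h0, MultilinearMap.map_update_sum]
      refine Finset.sum_congr rfl fun j _ => ?_
      congr 1
      ext i
      refine Fin.cases ?_ (fun i => ?_) i
      · simp only [Fin.cons_zero, Function.update_self]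
        congr 1
        ext i
        simp only [koszulInsert, Fin.lt_def, Fin.val_castAdd, Fin.castAdd_inj]
      · have h1 : ¬ (Fin.natAdd n i < Fin.castAdd m j) := by
          simp only [Fin.lt_def, Fin.val_natAdd, Fin.val_castAdd]; omega
        have h2 : Fin.natAdd n i ≠ Fin.castAdd m j := by
          intro h; have := congrArg Fin.val h; simp at this; omega
        simp [koszulInsert, h1, h2]
    · refine Finset.sum_congr rfl fun j _ => ?_
      congr 1
      ext i
      refine Fin.cases ?_ (fun i => ?_) i
      · simp only [Fin.cons_zero]
        rw [show koszulInsert A.mod j.succ (A.mod.dtSnd δ.toEndo (x (Fin.natAdd n j)))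
          (Fin.cons (A.act n b (fun i => A.mod.dtFst δ.toEndo (x (Fin.castAdd m i))))
            (fun i => A.mod.dtFst δ.toEndo (x (Fin.natAdd n i)))) 0 =
          A.mod.sgn (A.act n b (fun i => A.mod.dtFst δ.toEndo (x (Fin.castAdd m i)))) by
            simp [koszulInsert], sgn_act]
        congr 1
        ext i
        have h1 : Fin.castAdd m i < Fin.natAdd n j := by
          simp only [Fin.lt_def, Fin.val_natAdd, Fin.val_castAdd]; omega
        simp [koszulInsert, h1]
      · simp [koszulInsert]

variable (A) in
/-- The algebra `A ⊕ dt A`. -/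
noncomputable def dt : UAlg O where
  mod := A.mod.dt δ.toEndo
  act := A.dtAct δ
  act_mem := dt_act_mem δ
  d_act := dt_d_act δ
  act_map := dt_act_map δ
  act_one := dt_act_one δ
  act_comp := dt_act_comp δ

variable (A) in
/-- `u + dt v ↦ u` as a morphism of algebras. -/
noncomputable def dtFstHom : Hom (A.dt δ) A where
  toLin := A.mod.dtFst δ.toEndo
  map_gr _ _ hx := hx.1
  map_d _ := rfl
  map_act := A.dtFst_dtAct δ

/-- A morphism to `A` with values killed by the derivation, as a morphism to `A ⊕ dt A`. -/
noncomputable def dtInlHom {X : UAlg O} (f : Hom X A) (hf : ∀ x, δ.D (f.toLin x) = 0) :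
    Hom X (A.dt δ) where
  toLin := A.mod.dtInl δ.toEndo ∘ₗ f.toLin
  map_gr n x hx := ⟨f.map_gr n x hx, Submodule.zero_mem _⟩
  map_d x := DGMod.dt_ext (f.map_d x) (by
    change 0 = δ.D (f.toLin x) - A.mod.d 0
    rw [hf, map_zero, sub_zero])
  map_act n a x := DGMod.dt_ext ((f.map_act n a x).trans
    (A.dtFst_dtAct δ n a (fun i => A.mod.dtInl δ.toEndo (f.toLin (x i)))).symm) (by
    refine Eq.trans ?_ (A.dtSnd_dtAct δ n a _).symm
    refine (Finset.sum_eq_zero fun j _ => (A.act n _).map_coord_zero j ?_).symm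
    simp only [koszulInsert, lt_irrefl, if_false, if_true]
    rfl)

/-- Functoriality of `A ⊕ dt A`. -/
noncomputable def dtMap {B : UAlg O} (ε : B.Der) (f : Hom A B)
    (hf : ∀ x, f.toLin (δ.D x) = ε.D (f.toLin x)) : Hom (A.dt δ) (B.dt ε) where
  toLin := f.toLin.prodMap f.toLin
  map_gr n x hx := ⟨f.map_gr _ _ hx.1, f.map_gr _ _ hx.2⟩
  map_d x := DGMod.dt_ext (f.map_d _) (by
    change f.toLin (δ.D x.1 - A.mod.d x.2) = ε.D (f.toLin x.1) - B.mod.d (f.toLin x.2)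
    rw [map_sub, f.map_d, hf])
  map_act n a x := by
    refine DGMod.dt_ext ?_ ?_
    · refine Eq.trans ?_ (B.dtFst_dtAct ε n a _).symm
      exact (congrArg f.toLin (A.dtFst_dtAct δ n a x)).trans (f.map_act n a _)
    · refine Eq.trans ?_ (B.dtSnd_dtAct ε n a _).symm
      refine (congrArg f.toLin (A.dtSnd_dtAct δ n a x)).trans ?_
      rw [map_sum]
      refine Finset.sum_congr rfl fun j _ => ?_
      rw [f.map_act]
      congr 1
      ext i
      exact f.map_koszulInsert j _ _ i

end UAlg

end Dt

/-! ### Subalgebras, the truncation `red₀`, products -/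

section Sub

variable {k : Type u} [Field k]

/-- A graded subcomplex. -/
structure DGMod.Sub (V : DGMod k) where
  S : ℤ → Submodule k V
  le : ∀ n, S n ≤ V.gr n
  d : ∀ (n : ℤ) (x : V), x ∈ S (n + 1) → V.d x ∈ S n

theorem DGMod.Sub.d_mem_iSup {V : DGMod k} (T : V.Sub) (x : V) (hx : x ∈ iSup T.S) :
    V.d x ∈ iSup T.S := by
  have : iSup T.S ≤ (iSup T.S).comap V.d := by
    refine iSup_le fun n y hy => ?_
    exact Submodule.mem_iSup_of_mem (n - 1) (T.d (n - 1) y (by simpa using hy))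
  exact this hx

theorem DGMod.Sub.proj_mem_iSup {V : DGMod k} (T : V.Sub) (n : ℤ) (x : V) (hx : x ∈ iSup T.S) :
    V.proj n x ∈ iSup T.S := by
  have : iSup T.S ≤ (iSup T.S).comap (V.proj n) := by
    refine iSup_le fun m y hy => ?_
    rw [Submodule.mem_comap]
    by_cases h : n = m
    · subst h
      rw [DGMod.proj_of_mem (T.le n hy)]
      exact Submodule.mem_iSup_of_mem n hy
    · rw [DGMod.proj_of_mem_ne h (T.le m hy)]
      exact Submodule.zero_mem _
  exact this hx

/-- A graded subcomplex as a complex. -/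
noncomputable def DGMod.Sub.toMod {V : DGMod k} (T : V.Sub) : DGMod k where
  carrier := (iSup T.S : Submodule k V)
  gr n := (T.S n).comap (iSup T.S).subtype
  isInternal := by
    refine isInternal_of_proj _ (fun n => (V.proj n).restrict (T.proj_mem_iSup n)) ?_ ?_ ?_
    · intro n x hx
      exact Subtype.ext (DGMod.proj_of_mem (T.le n hx))
    · intro m n x hmn hx
      exact Subtype.ext (DGMod.proj_of_mem_ne hmn (T.le n hx))
    · rw [eq_top_iff]
      rintro ⟨x, hx⟩ -
      induction hx using Submodule.iSup_induction' with
      | mem n x hx => exact Submodule.mem_iSup_of_mem n hx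
      | zero => exact Submodule.zero_mem _
      | add x y hx hy h1 h2 => exact Submodule.add_mem _ h1 h2
  d := V.d.restrict T.d_mem_iSup
  d_mem n x hx := T.d n x hx
  d_d x := Subtype.ext (V.d_d x)

/-- The inclusion of a graded subcomplex. -/
noncomputable def DGMod.Sub.incl {V : DGMod k} (T : V.Sub) : DGMod.Hom T.toMod V where
  toLin := (iSup T.S).subtype
  map_gr n _ hx := T.le n hx
  map_d _ := rfl

theorem DGMod.Sub.incl_inj {V : DGMod k} (T : V.Sub) {x y : T.toMod}
    (h : T.incl.toLin x = T.incl.toLin y) : x = y := Subtype.ext h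

/-- Corestriction of a morphism to a graded subcomplex containing its image. -/
noncomputable def DGMod.Sub.lift {V W : DGMod k} (T : V.Sub) (f : DGMod.Hom W V)
    (hf : ∀ n x, x ∈ W.gr n → f.toLin x ∈ T.S n) : DGMod.Hom W T.toMod where
  toLin := f.toLin.codRestrict (iSup T.S) (fun x => by
    induction x using DGMod.induction_gr with
    | h n x hx => exact Submodule.mem_iSup_of_mem n (hf n x hx)
    | hadd x y h1 h2 => rw [map_add]; exact Submodule.add_mem _ h1 h2)
  map_gr n x hx := hf n x hx
  map_d x := Subtype.ext (f.map_d x)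

namespace UAlg

variable {O : Operad k}

/-- A subalgebra. -/
structure Sub (X : UAlg O) extends X.mod.Sub where
  act : ∀ (n : ℕ) (p : ℤ) (q : Fin n → ℤ) (a : O.obj (Fin n)) (x : Fin n → X.mod),
    a ∈ (O.obj (Fin n)).gr p → (∀ i, x i ∈ S (q i)) → X.act n a x ∈ S (p + ∑ i, q i)

variable {X : UAlg O}

theorem Sub.act_mem_iSup (T : X.Sub) (n : ℕ) (a : O.obj (Fin n))
    (x : Fin n → (iSup T.S : Submodule k X.mod)) :
    X.act n a (fun i => (x i : X.mod)) ∈ iSup T.S := by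
  induction a using DGMod.induction_gr with
  | hadd a b h1 h2 =>
    rw [map_add, _root_.add_apply]
    exact Submodule.add_mem _ h1 h2
  | h p a ha =>
    have : (Submodule.mkQ (iSup T.S)).compMultilinearMap
        ((X.act n a).compLinearMap (fun _ => (iSup T.S).subtype)) = 0 := by
      refine DGMod.multilinear_ext_gr (V := T.toSub.toMod) fun q y hy => ?_
      refine (Submodule.Quotient.mk_eq_zero _).2 ?_
      exact Submodule.mem_iSup_of_mem _ (T.act n p q a (fun i => (y i).1) ha hy)
    have h2 := congrArg (fun g => g x) this
    exact (Submodule.Quotient.mk_eq_zero _).1 h2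

/-- The structure maps of a subalgebra. -/
noncomputable def Sub.actHom (T : X.Sub) (n : ℕ) : O.obj (Fin n) →ₗ[k]
    MultilinearMap k (fun _ : Fin n => T.toSub.toMod.carrier) T.toSub.toMod.carrier where
  toFun a := ((X.act n a).compLinearMap (fun _ => (iSup T.S).subtype)).codRestrict (iSup T.S)
    (T.act_mem_iSup n a)
  map_add' a b := MultilinearMap.ext fun x => Subtype.ext (by simp; rfl)
  map_smul' c a := MultilinearMap.ext fun x => Subtype.ext (by simp; rfl)

theorem Sub.incl_actHom (T : X.Sub) (n : ℕ) (a : O.obj (Fin n)) (x : Fin n → T.toSub.toMod) :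
    T.incl.toLin (T.actHom n a x) = X.act n a (fun i => T.incl.toLin (x i)) := rfl

/-- A subalgebra as an algebra. -/
noncomputable def Sub.toAlg (T : X.Sub) : UAlg O where
  mod := T.toSub.toMod
  act := T.actHom
  act_mem n p q a x ha hx := T.act n p q a (fun i => T.incl.toLin (x i)) ha hx
  d_act n a x := T.incl_inj (by
    simp only [DGMod.Hom.map_d, map_add, map_sum, T.incl_actHom, DGMod.Hom.map_koszulInsert]
    exact X.d_act n a _)
  act_map n σ a q x hx := T.incl_inj (by
    simp only [map_smul, T.incl_actHom]
    exact X.act_map n σ a q _ fun i => T.incl.map_gr _ _ (hx i))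
  act_one x := T.incl_inj (by
    rw [T.incl_actHom]
    exact X.act_one _)
  act_comp m n a b x := T.incl_inj (by
    rw [T.incl_actHom, T.incl_actHom, X.act_comp]
    congr 1
    ext i
    refine Fin.cases ?_ (fun i => ?_) i
    · simp [T.incl_actHom]
    · simp)

/-- The inclusion of a subalgebra. -/
noncomputable def Sub.inclHom (T : X.Sub) : Hom T.toAlg X where
  toHom := T.toSub.incl
  map_act _ _ _ := rfl

/-- Corestriction of a morphism to a subalgebra containing its image. -/
noncomputable def Sub.liftHom {Y : UAlg O} (T : X.Sub) (f : Hom Y X)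
    (hf : ∀ n x, x ∈ Y.mod.gr n → f.toLin x ∈ T.S n) : Hom Y T.toAlg where
  toHom := T.toSub.lift f.toHom hf
  map_act n a x := Subtype.ext (f.map_act n a x)

/-- `red₀ C`: it is `C` in positive degrees, the kernel of `d` in degree `0`, and `0` in negative
degrees. -/
def red0Sub (V : DGMod k) (n : ℤ) : Submodule k V :=
  if 0 < n then V.gr n else if n = 0 then V.gr n ⊓ LinearMap.ker V.d else ⊥

theorem mem_red0Sub {V : DGMod k} {n : ℤ} {x : V} :
    x ∈ red0Sub V n ↔ x ∈ V.gr n ∧ (n = 0 → V.d x = 0) ∧ (n < 0 → x = 0) := by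
  unfold red0Sub
  split_ifs with h1 h2
  · simp [h1.ne', h1.not_gt]
  · subst h2; simp
  · have h3 : n < 0 := by omega
    simp only [Submodule.mem_bot, h2, h3, false_imp_iff, true_and, true_imp_iff]
    exact ⟨fun h => ⟨h ▸ Submodule.zero_mem _, h⟩, fun h => h.2⟩

/-- `red₀ X` as a subalgebra of `X`. -/
def red0Data (X : UAlg O) : X.Sub where
  S := red0Sub X.mod
  le n x hx := (mem_red0Sub.1 hx).1
  d n x hx := by
    rw [mem_red0Sub] at hx ⊢
    refine ⟨X.mod.d_mem n x hx.1, fun _ => X.mod.d_d x, fun hn => ?_⟩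
    rcases (show n + 1 = 0 ∨ n + 1 < 0 by omega) with h | h
    · exact hx.2.1 h
    · rw [hx.2.2 h, map_zero]
  act n p q a x ha hx := by
    simp only [mem_red0Sub] at hx ⊢
    have hmem := X.act_mem n p q a x ha (fun i => (hx i).1)
    by_cases hp : p < 0
    · have : a = 0 := by
        rw [O.nonneg (Fin n) p hp] at ha
        exact ha
      subst this
      simp
    by_cases hq : ∃ i, q i < 0
    · obtain ⟨i, hi⟩ := hq
      rw [(X.act n a).map_coord_zero i ((hx i).2.2 hi)]
      simp
    push Not at hq
    have hsum : 0 ≤ ∑ i, q i := Finset.sum_nonneg fun i _ => hq i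
    refine ⟨hmem, fun h0 => ?_, fun h => absurd h (by omega)⟩
    have hp0 : p = 0 := by omega
    have hq0 : ∀ i, q i = 0 := by
      have : ∑ i, q i = 0 := by omega
      intro i
      exact (Finset.sum_eq_zero_iff_of_nonneg (fun i _ => hq i)).1 this i (Finset.mem_univ i)
    have hda : (O.obj (Fin n)).d a = 0 := by
      subst hp0
      have := DGMod.d_mem' ha
      rw [O.nonneg (Fin n) _ (by norm_num)] at this
      exact this
    rw [X.d_act, hda, map_zero, _root_.zero_apply, zero_add]
    refine Finset.sum_eq_zero fun j _ => ?_
    refine (X.act n _).map_coord_zero j ?_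
    simp [koszulInsert, (hx j).2.1 (hq0 j)]

theorem red0Data_nonneg (X : UAlg O) : X.red0Data.toAlg.mod.IsNonneg := by
  intro n hn
  rw [eq_bot_iff]
  intro x hx
  exact Subtype.ext ((mem_red0Sub.1 hx).2.2 hn)

end UAlg

end Sub

section Prod

variable {k : Type u} [Field k]

/-- The product of two complexes. -/
noncomputable def DGMod.prod (V W : DGMod k) : DGMod k where
  carrier := V × W
  gr n := (V.gr n).prod (W.gr n)
  isInternal := by
    refine isInternal_of_proj _ (fun n => (V.proj n).prodMap (W.proj n)) ?_ ?_ ?_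
    · rintro n ⟨x, y⟩ ⟨hx, hy⟩
      exact Prod.ext (DGMod.proj_of_mem hx) (DGMod.proj_of_mem hy)
    · rintro m n ⟨x, y⟩ hmn ⟨hx, hy⟩
      exact Prod.ext (DGMod.proj_of_mem_ne hmn hx) (DGMod.proj_of_mem_ne hmn hy)
    · rw [eq_top_iff]
      rintro ⟨x, y⟩ -
      have h : (x, y) = (x, 0) + (0, y) := by simp
      rw [h]
      refine Submodule.add_mem _ ?_ ?_
      · induction x using DGMod.induction_gr with
        | h n x hx => exact Submodule.mem_iSup_of_mem n ⟨hx, Submodule.zero_mem _⟩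
        | hadd x y h1 h2 =>
          have : ((x + y, 0) : V × W) = (x, 0) + (y, 0) := by simp
          rw [this]; exact Submodule.add_mem _ (h1 (by simp)) (h2 (by simp))
      · induction y using DGMod.induction_gr with
        | h n x hx => exact Submodule.mem_iSup_of_mem n ⟨Submodule.zero_mem _, hx⟩
        | hadd x y h1 h2 =>
          have : ((0, x + y) : V × W) = (0, x) + (0, y) := by simp
          rw [this]; exact Submodule.add_mem _ (h1 (by simp)) (h2 (by simp))
  d := V.d.prodMap W.d
  d_mem := by
    rintro n ⟨x, y⟩ ⟨hx, hy⟩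
    exact ⟨V.d_mem n x hx, W.d_mem n y hy⟩
  d_d := by
    rintro ⟨x, y⟩
    exact Prod.ext (V.d_d x) (W.d_d y)

/-- The first projection. -/
noncomputable def DGMod.prodFst (V W : DGMod k) : DGMod.Hom (V.prod W) V where
  toLin := LinearMap.fst k V W
  map_gr _ _ hx := hx.1
  map_d _ := rfl

/-- The second projection. -/
noncomputable def DGMod.prodSnd (V W : DGMod k) : DGMod.Hom (V.prod W) W where
  toLin := LinearMap.snd k V W
  map_gr _ _ hx := hx.2
  map_d _ := rfl

theorem DGMod.prod_ext {V W : DGMod k} {x y : V.prod W}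
    (h1 : (V.prodFst W).toLin x = (V.prodFst W).toLin y)
    (h2 : (V.prodSnd W).toLin x = (V.prodSnd W).toLin y) : x = y := Prod.ext h1 h2

namespace UAlg

variable {O : Operad k} (X Y : UAlg O)

/-- The structure maps of a product. -/
noncomputable def prodAct (n : ℕ) : O.obj (Fin n) →ₗ[k]
    MultilinearMap k (fun _ : Fin n => (X.mod.prod Y.mod).carrier) (X.mod.prod Y.mod).carrier where
  toFun a := MultilinearMap.prod
    ((X.act n a).compLinearMap (fun _ => (X.mod.prodFst Y.mod).toLin))
    ((Y.act n a).compLinearMap (fun _ => (X.mod.prodSnd Y.mod).toLin))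
  map_add' a b := MultilinearMap.ext fun x => DGMod.prod_ext
    (by rw [map_add]; rfl) (by rw [map_add (Y.act n)]; rfl)
  map_smul' c a := MultilinearMap.ext fun x => DGMod.prod_ext
    (by rw [map_smul]; rfl) (by rw [map_smul (Y.act n)]; rfl)

theorem prodFst_act (n : ℕ) (a : O.obj (Fin n)) (x : Fin n → X.mod.prod Y.mod) :
    (X.mod.prodFst Y.mod).toLin (X.prodAct Y n a x) =
      X.act n a (fun i => (X.mod.prodFst Y.mod).toLin (x i)) := rfl

theorem prodSnd_act (n : ℕ) (a : O.obj (Fin n)) (x : Fin n → X.mod.prod Y.mod) :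
    (X.mod.prodSnd Y.mod).toLin (X.prodAct Y n a x) =
      Y.act n a (fun i => (X.mod.prodSnd Y.mod).toLin (x i)) := rfl

/-- The product of two algebras. -/
noncomputable def prod : UAlg O where
  mod := X.mod.prod Y.mod
  act := X.prodAct Y
  act_mem n p q a x ha hx :=
    ⟨X.act_mem n p q a _ ha fun i => (hx i).1, Y.act_mem n p q a _ ha fun i => (hx i).2⟩
  d_act n a x := DGMod.prod_ext
    (by
      simp only [DGMod.Hom.map_d, map_add, map_sum, prodFst_act, DGMod.Hom.map_koszulInsert]
      exact X.d_act n a _)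
    (by
      simp only [DGMod.Hom.map_d, map_add, map_sum, prodSnd_act, DGMod.Hom.map_koszulInsert]
      exact Y.d_act n a _)
  act_map n σ a q x hx := DGMod.prod_ext
    (by
      simp only [map_smul, prodFst_act]
      exact X.act_map n σ a q _ fun i => (hx i).1)
    (by
      simp only [map_smul, prodSnd_act]
      exact Y.act_map n σ a q _ fun i => (hx i).2)
  act_one x := DGMod.prod_ext (by rw [prodFst_act]; exact X.act_one _)
    (by rw [prodSnd_act]; exact Y.act_one _)
  act_comp m n a b x := DGMod.prod_ext
    (by
      rw [prodFst_act, prodFst_act, X.act_comp]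
      congr 1
      ext i
      refine Fin.cases ?_ (fun i => ?_) i
      · simp [prodFst_act]
      · simp)
    (by
      rw [prodSnd_act, prodSnd_act, Y.act_comp]
      congr 1
      ext i
      refine Fin.cases ?_ (fun i => ?_) i
      · simp [prodSnd_act]
      · simp)

variable {X Y} {Z : UAlg O}

/-- The fibre product, as a subalgebra of the product. -/
noncomputable def pullbackData (f : Hom X Z) (g : Hom Y Z) : (X.prod Y).Sub where
  S n := ((X.mod.gr n).prod (Y.mod.gr n)) ⊓
    LinearMap.ker (f.toLin ∘ₗ LinearMap.fst k X.mod Y.mod - g.toLin ∘ₗ LinearMap.snd k X.mod Y.mod)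
  le n x hx := hx.1
  d n x hx := ⟨(X.prod Y).mod.d_mem n x hx.1, by
    have h : f.toLin x.1 - g.toLin x.2 = 0 := hx.2
    change f.toLin (X.mod.d x.1) - g.toLin (Y.mod.d x.2) = 0
    rw [f.map_d, g.map_d, ← map_sub, h, map_zero]⟩
  act n p q a x ha hx := ⟨(X.prod Y).act_mem n p q a x ha fun i => (hx i).1, by
    have h : ∀ i, f.toLin (x i).1 - g.toLin (x i).2 = 0 := fun i => (hx i).2
    change f.toLin (X.act n a (fun i => (x i).1)) - g.toLin (Y.act n a (fun i => (x i).2)) = 0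
    rw [f.map_act, g.map_act]
    simp only [fun i => sub_eq_zero.1 (h i), sub_self]⟩

end UAlg

end Prod

/-! ### The category of nonnegatively graded algebras -/

section Cat

variable {k : Type u} [Field k]

/-- Algebras over `O` in nonnegatively graded chain complexes. -/
structure Alg (O : Operad k) extends UAlg O where
  nonneg : mod.IsNonneg

namespace Alg

variable {O : Operad k}

instance : Category (Alg O) where
  Hom X Y := UAlg.Hom X.toUAlg Y.toUAlg
  id X := UAlg.Hom.id X.toUAlg
  comp f g := UAlg.Hom.comp f g

/-- The linear map underlying a morphism. -/
def lin {X Y : Alg O} (f : X ⟶ Y) : X.mod →ₗ[k] Y.mod := DGMod.Hom.toLin (UAlg.Hom.toHom f)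

theorem hom_ext {X Y : Alg O} {f g : X ⟶ Y} (h : ∀ x, lin f x = lin g x) : f = g :=
  UAlg.Hom.ext (LinearMap.ext h)

@[simp] theorem lin_id (X : Alg O) (x : X.mod) : lin (𝟙 X) x = x := rfl

@[simp] theorem lin_comp {X Y Z : Alg O} (f : X ⟶ Y) (g : Y ⟶ Z) (x : X.mod) :
    lin (f ≫ g) x = lin g (lin f x) := rfl

/-- Weak equivalences: quasi-isomorphisms of the underlying complexes. -/
def weakEquivalences (O : Operad k) : MorphismProperty (Alg O) :=
  fun _ _ f => DGMod.Hom.IsQuasiIso (UAlg.Hom.toHom f)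

/-- Fibrations of the projective model structure on nonnegatively graded complexes: surjections in
positive degrees. -/
def fibrations (O : Operad k) : MorphismProperty (Alg O) :=
  fun X Y f => ∀ n : ℤ, 0 < n → ∀ y ∈ Y.mod.gr n, ∃ x ∈ X.mod.gr n, lin f x = y

/-! Fibre products. -/

/-- The fibre product. -/
noncomputable def fibreProduct {X Y Z : Alg O} (f : X ⟶ Z) (g : Y ⟶ Z) : Alg O where
  toUAlg := (UAlg.pullbackData f g).toAlg
  nonneg n hn := by
    rw [eq_bot_iff]
    rintro ⟨⟨x, y⟩, h⟩ ⟨⟨hx, hy⟩, -⟩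
    refine Subtype.ext (Prod.ext ?_ ?_)
    · have hx' : x ∈ X.mod.gr n := hx
      rw [X.nonneg n hn] at hx'
      exact hx'
    · have hy' : y ∈ Y.mod.gr n := hy
      rw [Y.nonneg n hn] at hy'
      exact hy'

/-- The first projection. -/
noncomputable def fibreFst {X Y Z : Alg O} (f : X ⟶ Z) (g : Y ⟶ Z) : fibreProduct f g ⟶ X :=
  UAlg.Hom.comp (UAlg.pullbackData f g).inclHom
    { toHom := X.mod.prodFst Y.mod
      map_act := fun _ _ _ => rfl }

/-- The second projection. -/
noncomputable def fibreSnd {X Y Z : Alg O} (f : X ⟶ Z) (g : Y ⟶ Z) : fibreProduct f g ⟶ Y :=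
  UAlg.Hom.comp (UAlg.pullbackData f g).inclHom
    { toHom := X.mod.prodSnd Y.mod
      map_act := fun _ _ _ => rfl }

theorem fibre_ext {X Y Z : Alg O} {f : X ⟶ Z} {g : Y ⟶ Z} {x y : (fibreProduct f g).mod}
    (h1 : lin (fibreFst f g) x = lin (fibreFst f g) y)
    (h2 : lin (fibreSnd f g) x = lin (fibreSnd f g) y) : x = y :=
  Subtype.ext (Prod.ext h1 h2)

theorem fibre_condition {X Y Z : Alg O} (f : X ⟶ Z) (g : Y ⟶ Z) :
    fibreFst f g ≫ f = fibreSnd f g ≫ g := by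
  refine hom_ext fun ⟨x, hx⟩ => ?_
  have h : iSup (UAlg.pullbackData f g).S ≤
      LinearMap.ker (lin f ∘ₗ LinearMap.fst k X.mod Y.mod - lin g ∘ₗ LinearMap.snd k X.mod Y.mod) :=
    iSup_le fun n y hy => hy.2
  have h2 : lin f x.1 - lin g x.2 = 0 := h hx
  exact sub_eq_zero.1 h2

/-- The universal morphism to a fibre product. -/
noncomputable def fibreLift {X Y Z W : Alg O} (f : X ⟶ Z) (g : Y ⟶ Z) (a : W ⟶ X) (b : W ⟶ Y)
    (h : a ≫ f = b ≫ g) : W ⟶ fibreProduct f g :=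
  (UAlg.pullbackData f g).liftHom
    { toLin := (lin a).prod (lin b)
      map_gr := fun n x hx => ⟨a.map_gr n x hx, b.map_gr n x hx⟩
      map_d := fun x => Prod.ext (a.map_d x) (b.map_d x)
      map_act := fun n o x => Prod.ext (a.map_act n o x) (b.map_act n o x) }
    (fun n x hx => ⟨⟨a.map_gr n x hx, b.map_gr n x hx⟩,
      sub_eq_zero.2 (congrArg (fun φ => lin φ x) h)⟩)

/-- The fibre product is a pullback in the category of algebras. -/
noncomputable def fibreIsLimit {X Y Z : Alg O} (f : X ⟶ Z) (g : Y ⟶ Z) :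
    Limits.IsLimit (Limits.PullbackCone.mk _ _ (fibre_condition f g)) :=
  Limits.PullbackCone.IsLimit.mk _ (fun s => fibreLift f g s.fst s.snd s.condition)
    (fun _ => rfl) (fun _ => rfl)
    (fun _ _ h1 h2 => hom_ext fun x => fibre_ext
      (congrArg (fun φ => lin φ x) h1) (congrArg (fun φ => lin φ x) h2))

instance : Limits.HasPullbacks (Alg O) := by
  have : ∀ {X Y Z : Alg O} {f : X ⟶ Z} {g : Y ⟶ Z}, Limits.HasLimit (Limits.cospan f g) :=
    fun {_ _ _ f g} => ⟨⟨⟨_, fibreIsLimit f g⟩⟩⟩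
  exact Limits.hasPullbacks_of_hasLimit_cospan _

/-- The functor `red₀` on objects. -/
noncomputable def red0 (X : UAlg O) : Alg O where
  toUAlg := X.red0Data.toAlg
  nonneg := X.red0Data_nonneg

/-- The functor `red₀` on morphisms. -/
noncomputable def red0Map {X Y : UAlg O} (f : UAlg.Hom X Y) : red0 X ⟶ red0 Y :=
  Y.red0Data.liftHom (UAlg.Hom.comp X.red0Data.inclHom f) (fun n x hx => by
    have h := UAlg.mem_red0Sub.1 hx
    refine UAlg.mem_red0Sub.2 ⟨f.map_gr n _ h.1, fun hn => ?_, fun hn => ?_⟩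
    · exact (f.map_d _).symm.trans ((congrArg f.toLin (h.2.1 hn)).trans (map_zero _))
    · exact (congrArg f.toLin (h.2.2 hn)).trans (map_zero _))

end Alg

end Cat

/-! ### The path object -/

section Path

variable {k : Type u} [Field k] [CharZero k] {O : Operad k}

namespace UAlg

/-- Evaluation `k[t] ⊗ X ⟶ X` at `c`. -/
noncomputable def polyEval (X : UAlg O) (c : k) : Hom X.poly X where
  toHom := X.mod.evalHom c
  map_act := X.evalHom_polyAct c

theorem polyEval_ext {X : UAlg O} {w w' : X.poly.mod}
    (h : ∀ c, (X.polyEval c).toLin w = (X.polyEval c).toLin w') : w = w' :=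
  DGMod.evalHom_ext h

/-- `x ↦ 1 ⊗ x`. -/
noncomputable def polyUnit (X : UAlg O) : Hom X X.poly where
  toLin := TensorProduct.mk k (Polynomial k) X.mod 1
  map_gr n x hx := ⟨1 ⊗ₜ ⟨x, hx⟩, rfl⟩
  map_d _ := rfl
  map_act n a x := by
    refine Eq.trans ?_ (polyExt_tmul (X.act n a) (fun _ => 1) x).symm
    rw [Finset.prod_const_one]
    rfl

/-- The linear map underlying the functoriality of `k[t] ⊗ X`. -/
noncomputable def polyMapLin {X Y : UAlg O} (f : Hom X Y) : X.poly.mod →ₗ[k] Y.poly.mod :=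
  f.toLin.lTensor (Polynomial k)

theorem polyEval_polyMapLin {X Y : UAlg O} (f : Hom X Y) (c : k) (x : X.poly.mod) :
    (Y.polyEval c).toLin (polyMapLin f x) = f.toLin ((X.polyEval c).toLin x) :=
  evalAt_lTensor c f.toLin x

/-- Functoriality of `k[t] ⊗ X`. -/
noncomputable def polyMap {X Y : UAlg O} (f : Hom X Y) : Hom X.poly Y.poly where
  toLin := polyMapLin f
  map_gr n x hx := DGMod.mem_poly_of_evalHom _ fun c => by
    refine (polyEval_polyMapLin f c x).symm ▸ ?_
    exact f.map_gr n _ ((X.polyEval c).map_gr n x hx)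
  map_d x := polyEval_ext fun c => by
    rw [polyEval_polyMapLin, (X.polyEval c).map_d, (Y.polyEval c).map_d, f.map_d,
      polyEval_polyMapLin]
  map_act n a x := polyEval_ext fun c => by
    rw [polyEval_polyMapLin, (X.polyEval c).map_act, (Y.polyEval c).map_act, f.map_act]
    simp only [polyEval_polyMapLin]

/-- The derivation `∂/∂t` of `k[t] ⊗ X`. -/
noncomputable def polyDer (X : UAlg O) : X.poly.Der where
  D := X.mod.deriv
  mem _ _ hx := X.mod.deriv_mem hx
  comm := X.mod.deriv_d
  leibniz := X.deriv_polyAct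

/-- The algebra `Λ(t, dt) ⊗ X = (k[t] ⊗ X) ⊕ dt (k[t] ⊗ X)`, where `Λ(t, dt) = k[t] ⊕ k[t] dt` is
the free graded commutative differential algebra on `t` of degree `0` and `dt` of degree `-1`.
The pair `(P ⊗ x, Q ⊗ y)` stands for `P ⊗ x + (Q dt) ⊗ y`; its differential is
`P ⊗ d x + (P' dt) ⊗ x - (Q dt) ⊗ d y`, and the structure maps are
`m (a; α₁ ⊗ x₁, …, αₙ ⊗ xₙ) = ± (α₁ ⋯ αₙ) ⊗ m (a; x₁, …, xₙ)` with the Koszul sign. -/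
noncomputable def lambdaTensor (X : UAlg O) : UAlg O := X.poly.dt X.polyDer

/-- The augmentation `P ⊗ x + (Q dt) ⊗ y ↦ P(c) x`. -/
noncomputable def lambdaEval (X : UAlg O) (c : k) : Hom X.lambdaTensor X :=
  Hom.comp (X.poly.dtFstHom X.polyDer) (X.polyEval c)

/-- The unit `x ↦ 1 ⊗ x`. -/
noncomputable def lambdaUnit (X : UAlg O) : Hom X X.lambdaTensor :=
  dtInlHom X.polyDer X.polyUnit (fun x => by
    refine (polyDeriv_tmul 1 x).trans ?_
    rw [Polynomial.derivative_one, TensorProduct.zero_tmul]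
    rfl)

/-- Functoriality of `Λ(t, dt) ⊗ X`. -/
noncomputable def lambdaMap {X Y : UAlg O} (f : Hom X Y) : Hom X.lambdaTensor Y.lambdaTensor :=
  dtMap X.polyDer Y.polyDer (polyMap f) (fun x => (polyDeriv_lTensor f.toLin x).symm)

end UAlg

namespace Alg

/-- The path object `Z^I = red₀ (Λ(t, dt) ⊗ Z)`. -/
noncomputable def path (Z : Alg O) : Alg O := red0 Z.toUAlg.lambdaTensor

/-- The morphism `Z^I ⟶ Z` induced by `P + Q dt ↦ P(c)`. -/
noncomputable def pathEval (c : k) (Z : Alg O) : path Z ⟶ Z :=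
  UAlg.Hom.comp Z.toUAlg.lambdaTensor.red0Data.inclHom (Z.toUAlg.lambdaEval c)

/-- `p₀ : Z^I ⟶ Z`. -/
noncomputable abbrev p0 (Z : Alg O) : path Z ⟶ Z := pathEval 0 Z

/-- `p₁ : Z^I ⟶ Z`. -/
noncomputable abbrev p1 (Z : Alg O) : path Z ⟶ Z := pathEval 1 Z

/-- `s₀ : Z ⟶ Z^I`, `z ↦ 1 ⊗ z`. -/
noncomputable def s0 (Z : Alg O) : Z ⟶ path Z :=
  Z.toUAlg.lambdaTensor.red0Data.liftHom Z.toUAlg.lambdaUnit (fun n x hx => by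
    have hd : ∀ m < 0, ∀ y ∈ Z.mod.gr m, y = 0 := fun m hm y hy => by
      rw [Z.nonneg m hm] at hy
      exact hy
    refine UAlg.mem_red0Sub.2 ⟨Z.toUAlg.lambdaUnit.map_gr n x hx, fun hn => ?_, fun hn => ?_⟩
    · rw [← Z.toUAlg.lambdaUnit.map_d, hd (n - 1) (by omega) _ (DGMod.d_mem' hx), map_zero]
    · rw [hd n hn x hx, map_zero])

@[simp] theorem s0_pathEval (c : k) (Z : Alg O) : s0 Z ≫ pathEval c Z = 𝟙 Z := by
  refine hom_ext fun x => ?_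
  change evalAt Z.mod c (1 ⊗ₜ[k] x) = x
  simp

/-- Functoriality of the path object. -/
noncomputable def pathMap {Z Z' : Alg O} (f : Z ⟶ Z') : path Z ⟶ path Z' :=
  red0Map (UAlg.lambdaMap f)

theorem pathMap_eval (c : k) {Z Z' : Alg O} (f : Z ⟶ Z') :
    pathMap f ≫ pathEval c Z' = pathEval c Z ≫ f :=
  hom_ext fun _ => evalAt_lTensor c (lin f) _

theorem s0_pathMap {Z Z' : Alg O} (f : Z ⟶ Z') : s0 Z ≫ pathMap f = f ≫ s0 Z' := by
  refine hom_ext fun x => Subtype.ext (Prod.ext ?_ ?_)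
  · rfl
  · exact map_zero (UAlg.polyMap f).toLin

open Limits

/-- The factorisation of `f : Y ⟶ Z`: the algebra `Z^I ×_Z Y`, the pullback of `p₀` and `f`. -/
noncomputable abbrev mappingPath {Y Z : Alg O} (f : Y ⟶ Z) : Alg O := pullback (p0 Z) f

/-- The morphism `p₁ ∘ π₁ : Z^I ×_Z Y ⟶ Z`. -/
noncomputable abbrev mappingPathEnd {Y Z : Alg O} (f : Y ⟶ Z) : mappingPath f ⟶ Z :=
  pullback.fst (p0 Z) f ≫ p1 Z

/-- The morphism `(s₀ f, id) : Y ⟶ Z^I ×_Z Y`. -/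
noncomputable def toMappingPath {Y Z : Alg O} (f : Y ⟶ Z) : Y ⟶ mappingPath f :=
  pullback.lift (f ≫ s0 Z) (𝟙 Y) (by simp [p0])

@[simp] theorem toMappingPath_end {Y Z : Alg O} (f : Y ⟶ Z) : toMappingPath f ≫ mappingPathEnd f = f := by
  rw [toMappingPath, mappingPathEnd, pullback.lift_fst_assoc, Category.assoc, s0_pathEval,
    Category.comp_id]

variable (O)

/-- Diagrams `X ⟶ Z ⟵ Y` of algebras. -/
abbrev Cospan := WalkingCospan ⥤ Alg O

variable {O}

/-- `P_D = X ×_Z Z^I ×_Z Y`, the pullback of `g : X ⟶ Z` and `p₁ ∘ π₁ : Z^I ×_Z Y ⟶ Z`. -/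
noncomputable def modelObj (D : Cospan O) : Alg O :=
  pullback (D.map WalkingCospan.Hom.inl) (mappingPathEnd (D.map WalkingCospan.Hom.inr))

/-- Functoriality of `Z^I ×_Z Y`. -/
noncomputable def mappingPathMap {Y Z Y' Z' : Alg O} (f : Y ⟶ Z) (f' : Y' ⟶ Z') (y : Y ⟶ Y')
    (z : Z ⟶ Z') (h : f ≫ z = y ≫ f') : mappingPath f ⟶ mappingPath f' :=
  pullback.map _ _ _ _ (pathMap z) y z (pathMap_eval 0 z).symm h

theorem mappingPathMap_fst {Y Z Y' Z' : Alg O} (f : Y ⟶ Z) (f' : Y' ⟶ Z') (y : Y ⟶ Y')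
    (z : Z ⟶ Z') (h : f ≫ z = y ≫ f') :
    mappingPathMap f f' y z h ≫ pullback.fst (p0 Z') f' = pullback.fst (p0 Z) f ≫ pathMap z :=
  pullback.lift_fst _ _ _

theorem mappingPathMap_snd {Y Z Y' Z' : Alg O} (f : Y ⟶ Z) (f' : Y' ⟶ Z') (y : Y ⟶ Y')
    (z : Z ⟶ Z') (h : f ≫ z = y ≫ f') :
    mappingPathMap f f' y z h ≫ pullback.snd (p0 Z') f' = pullback.snd (p0 Z) f ≫ y :=
  pullback.lift_snd _ _ _

theorem mappingPathMap_end {Y Z Y' Z' : Alg O} (f : Y ⟶ Z) (f' : Y' ⟶ Z') (y : Y ⟶ Y')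
    (z : Z ⟶ Z') (h : f ≫ z = y ≫ f') :
    mappingPathEnd f ≫ z = mappingPathMap f f' y z h ≫ mappingPathEnd f' := by
  rw [mappingPathEnd, mappingPathEnd, Category.assoc, ← pathMap_eval, ← Category.assoc,
    ← mappingPathMap_fst f f' y z h, Category.assoc]

theorem toMappingPath_fst {Y Z : Alg O} (f : Y ⟶ Z) :
    toMappingPath f ≫ pullback.fst (p0 Z) f = f ≫ s0 Z :=
  pullback.lift_fst _ _ _

theorem toMappingPath_snd {Y Z : Alg O} (f : Y ⟶ Z) :
    toMappingPath f ≫ pullback.snd (p0 Z) f = 𝟙 Y :=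
  pullback.lift_snd _ _ _

theorem toMappingPath_map {Y Z Y' Z' : Alg O} (f : Y ⟶ Z) (f' : Y' ⟶ Z') (y : Y ⟶ Y')
    (z : Z ⟶ Z') (h : f ≫ z = y ≫ f') :
    toMappingPath f ≫ mappingPathMap f f' y z h = y ≫ toMappingPath f' := by
  apply pullback.hom_ext
  · rw [Category.assoc, Category.assoc, mappingPathMap_fst, toMappingPath_fst, ← Category.assoc,
      toMappingPath_fst, Category.assoc, s0_pathMap, ← Category.assoc, ← Category.assoc, h]
  · rw [Category.assoc, Category.assoc, mappingPathMap_snd, toMappingPath_snd, ← Category.assoc,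
      toMappingPath_snd, Category.id_comp, Category.comp_id]

theorem cospan_naturality_right {D D' : Cospan O} (φ : D ⟶ D') :
    D.map WalkingCospan.Hom.inr ≫ φ.app WalkingCospan.one =
      φ.app WalkingCospan.right ≫ D'.map WalkingCospan.Hom.inr :=
  φ.naturality WalkingCospan.Hom.inr

theorem cospan_naturality_left {D D' : Cospan O} (φ : D ⟶ D') :
    D.map WalkingCospan.Hom.inl ≫ φ.app WalkingCospan.one =
      φ.app WalkingCospan.left ≫ D'.map WalkingCospan.Hom.inl :=
  φ.naturality WalkingCospan.Hom.inl

/-- The projection `P_D ⟶ X`. -/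
noncomputable def modelFst (D : Cospan O) : modelObj D ⟶ D.obj WalkingCospan.left :=
  pullback.fst (D.map WalkingCospan.Hom.inl) (mappingPathEnd (D.map WalkingCospan.Hom.inr))

/-- The projection `P_D ⟶ Z^I ×_Z Y`. -/
noncomputable def modelSnd (D : Cospan O) :
    modelObj D ⟶ mappingPath (D.map WalkingCospan.Hom.inr) :=
  pullback.snd (D.map WalkingCospan.Hom.inl) (mappingPathEnd (D.map WalkingCospan.Hom.inr))

theorem modelObj_hom_ext {W : Alg O} {D : Cospan O} {f g : W ⟶ modelObj D}
    (h₁ : f ≫ modelFst D = g ≫ modelFst D) (h₂ : f ≫ modelSnd D = g ≫ modelSnd D) : f = g :=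
  pullback.hom_ext h₁ h₂

/-- Functoriality of `P_D`. -/
noncomputable def modelMap {D D' : Cospan O} (φ : D ⟶ D') : modelObj D ⟶ modelObj D' :=
  pullback.map _ _ _ _ (φ.app WalkingCospan.left)
    (mappingPathMap _ _ _ _ (cospan_naturality_right φ)) (φ.app WalkingCospan.one)
    (cospan_naturality_left φ) (mappingPathMap_end _ _ _ _ _)

theorem modelMap_fst {D D' : Cospan O} (φ : D ⟶ D') :
    modelMap φ ≫ modelFst D' = modelFst D ≫ φ.app WalkingCospan.left :=
  pullback.lift_fst _ _ _

theorem modelMap_snd {D D' : Cospan O} (φ : D ⟶ D') :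
    modelMap φ ≫ modelSnd D' =
      modelSnd D ≫ mappingPathMap _ _ _ _ (cospan_naturality_right φ) :=
  pullback.lift_snd _ _ _

theorem pathMap_id (Z : Alg O) : pathMap (𝟙 Z) = 𝟙 (path Z) :=
  hom_ext fun _ => Subtype.ext (Prod.ext
    (congrFun (congrArg DFunLike.coe (LinearMap.lTensor_id (Polynomial k) Z.mod)) _)
    (congrFun (congrArg DFunLike.coe (LinearMap.lTensor_id (Polynomial k) Z.mod)) _))

theorem pathMap_comp {Z Z' Z'' : Alg O} (f : Z ⟶ Z') (g : Z' ⟶ Z'') :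
    pathMap (f ≫ g) = pathMap f ≫ pathMap g :=
  hom_ext fun _ => Subtype.ext (Prod.ext
    (congrFun (congrArg DFunLike.coe (LinearMap.lTensor_comp (Polynomial k) (lin g) (lin f))) _)
    (congrFun (congrArg DFunLike.coe (LinearMap.lTensor_comp (Polynomial k) (lin g) (lin f))) _))

theorem mappingPathMap_id {Y Z : Alg O} (f : Y ⟶ Z) (h : f ≫ 𝟙 Z = 𝟙 Y ≫ f) :
    mappingPathMap f f (𝟙 Y) (𝟙 Z) h = 𝟙 (mappingPath f) := by
  apply pullback.hom_ext
  · rw [mappingPathMap_fst, pathMap_id, Category.comp_id, Category.id_comp]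
  · rw [mappingPathMap_snd, Category.comp_id, Category.id_comp]

theorem mappingPathMap_comp {Y Z Y' Z' Y'' Z'' : Alg O} (f : Y ⟶ Z) (f' : Y' ⟶ Z')
    (f'' : Y'' ⟶ Z'') (y : Y ⟶ Y') (z : Z ⟶ Z') (y' : Y' ⟶ Y'') (z' : Z' ⟶ Z'')
    (h : f ≫ z = y ≫ f') (h' : f' ≫ z' = y' ≫ f'') (h'' : f ≫ z ≫ z' = (y ≫ y') ≫ f'') :
    mappingPathMap f f'' (y ≫ y') (z ≫ z') h'' =
      mappingPathMap f f' y z h ≫ mappingPathMap f' f'' y' z' h' := by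
  apply pullback.hom_ext
  · rw [mappingPathMap_fst, Category.assoc, mappingPathMap_fst, ← Category.assoc,
      mappingPathMap_fst, pathMap_comp, Category.assoc]
  · rw [mappingPathMap_snd, Category.assoc, mappingPathMap_snd,
      ← Category.assoc (mappingPathMap f f' y z h), mappingPathMap_snd, Category.assoc]

/-- The functor `D ↦ P_D = X ×_Z Z^I ×_Z Y`. -/
noncomputable def model (O : Operad k) : Cospan O ⥤ Alg O where
  obj := modelObj
  map := modelMap
  map_id D := by
    apply modelObj_hom_ext
    · rw [modelMap_fst, Category.id_comp]
      exact Category.comp_id _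
    · rw [modelMap_snd, Category.id_comp]
      exact (congrArg (modelSnd D ≫ ·) (mappingPathMap_id _ _)).trans (Category.comp_id _)
  map_comp φ ψ := by
    apply modelObj_hom_ext
    · rw [modelMap_fst, Category.assoc, modelMap_fst, ← Category.assoc, modelMap_fst,
        Category.assoc]
      rfl
    · rw [modelMap_snd, Category.assoc, modelMap_snd, ← Category.assoc, modelMap_snd,
        Category.assoc]
      exact congrArg (modelSnd _ ≫ ·) (mappingPathMap_comp _ _ _ _ _ _ _ _ _ _)

/-- The morphism `X ×_Z Y ⟶ P_D`, `(x, y) ↦ (x, s₀ (f y), y)`. -/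
noncomputable def comparisonApp (D : Cospan O) : limit D ⟶ modelObj D :=
  pullback.lift (limit.π D WalkingCospan.left)
    (limit.π D WalkingCospan.right ≫ toMappingPath (D.map WalkingCospan.Hom.inr)) (by
      rw [Category.assoc, toMappingPath_end]
      exact (limit.w D WalkingCospan.Hom.inl).trans (limit.w D WalkingCospan.Hom.inr).symm)

theorem comparisonApp_fst (D : Cospan O) :
    comparisonApp D ≫ modelFst D = limit.π D WalkingCospan.left :=
  pullback.lift_fst _ _ _

theorem comparisonApp_snd (D : Cospan O) :
    comparisonApp D ≫ modelSnd D =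
      limit.π D WalkingCospan.right ≫ toMappingPath (D.map WalkingCospan.Hom.inr) :=
  pullback.lift_snd _ _ _

/-- The natural comparison `X ×_Z Y ⟶ X ×_Z Z^I ×_Z Y`. -/
noncomputable def comparison (O : Operad k) : (lim : Cospan O ⥤ Alg O) ⟶ model O where
  app := comparisonApp
  naturality D D' φ := by
    change limMap φ ≫ comparisonApp D' = comparisonApp D ≫ modelMap φ
    apply modelObj_hom_ext
    · rw [Category.assoc, Category.assoc, comparisonApp_fst, modelMap_fst, ← Category.assoc,
        comparisonApp_fst, limMap_π]
    · rw [Category.assoc, Category.assoc, comparisonApp_snd, modelMap_snd, ← Category.assoc,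
        ← Category.assoc, comparisonApp_snd, limMap_π, Category.assoc, Category.assoc,
        toMappingPath_map]

/-! ### Homotopy pullbacks -/

/-- Objectwise weak equivalences of diagrams `X ⟶ Z ⟵ Y`. -/
abbrev cospanWeakEquivalences (O : Operad k) : MorphismProperty (Cospan O) :=
  (weakEquivalences O).functorCategory WalkingCospan

/-- A diagram `X ⟶ Z ⟵ Y` of fibrations.  (All objects of `Alg O` are fibrant.) -/
def IsFibrantCospan (D : Cospan O) : Prop :=
  fibrations O (D.map WalkingCospan.Hom.inl) ∧ fibrations O (D.map WalkingCospan.Hom.inr)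

/-- A functor `P` on diagrams `X ⟶ Z ⟵ Y`, with a natural transformation `α` from the strict
pullback, is a homotopy pullback functor if it preserves weak equivalences and, with `α`, induces
on homotopy categories the total right derived functor of the pullback functor. -/
def IsHomotopyPullback (P : Cospan O ⥤ Alg O) (α : (lim : Cospan O ⥤ Alg O) ⟶ P) : Prop :=
  (∀ ⦃D D' : Cospan O⦄ (φ : D ⟶ D'), cospanWeakEquivalences O φ → weakEquivalences O (P.map φ)) ∧
  ∃ hP : (cospanWeakEquivalences O).IsInvertedBy (P ⋙ (weakEquivalences O).Q),
    (Localization.lift (P ⋙ (weakEquivalences O).Q) hP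
      (cospanWeakEquivalences O).Q).IsRightDerivedFunctor
        (Functor.whiskerRight α (weakEquivalences O).Q ≫
          (Localization.fac (P ⋙ (weakEquivalences O).Q) hP (cospanWeakEquivalences O).Q).inv)
        (cospanWeakEquivalences O)

end Alg

end Path

end DGOperad

namespace DGOperad

/-! ### Quasi-isomorphisms in terms of elements -/

section QuasiIso

variable {k : Type u} [Field k]

namespace DGMod

variable {V W : DGMod k}

/-! The operad enters only through the constructions; every claim about weak equivalences and
fibrations is one about underlying complexes. Two facts carry the proof.

The first is a Poincaré lemma. In characteristic 0 polynomials have primitives. If `u + dt v` is a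
cycle of `Λ(t, dt) ⊗ Z`, then `∂u/∂t = d v`, and integrating `v` from `c` to `t` gives an element
with differential `(u - u(c)) + dt v`. Thus evaluation at `c` followed by `s₀` moves a cycle only by
a boundary, and `s₀` and all evaluations are weak equivalences (`weakEquivalences_pathEval`). The
segment `(1 - t) z₀ + t z₁` joins any two elements of the same positive degree (`path_endpoints`).
In degree 0 only cycles of `Λ(t, dt) ⊗ Z` are kept, so only homologous elements are joined there;
this is why `(p₀, p₁)` is merely a fibration.

The second is the gluing lemma `weakEquivalences_of_isPullback`: pullbacks with one leg a fibration
are invariant under weak equivalence of cospans. It is a chase with elements: the failure of chosen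
elements of `X` and `Y` to agree in `Z` is a boundary, and the element it bounds has positive
degree, so a fibration lifts it.

Together they factor every `f : Y ⟶ Z` as a weak equivalence `Y ⟶ Z^I ×_Z Y` followed by a
fibration. Since `P_D` is a pullback along that fibration, gluing shows that it preserves weak
equivalences and that `c_D` is a weak equivalence as soon as `f` is a fibration. Factoring both legs
gives a functorial replacement of a diagram by a diagram of fibrations.

The passage to homotopy categories is then formal (`isRightDerivedFunctor_of_replacement`): a
functor on the localization with a transformation from `F` that is invertible on a functorial
replacement is the right derived functor of `F`. No model structure on algebras is needed. -/

theorem mk_cycle_eq_zero {n : ℤ} (x : V.cycles n) :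
    (Submodule.Quotient.mk x : V.homology n) = 0 ↔ ∃ y ∈ V.gr (n + 1), V.d y = x :=
  (Submodule.Quotient.mk_eq_zero _).trans Iff.rfl

/-- This form and the one for surjectivity remove the quotients, so that the gluing lemma can be
proved by choosing cycles and bounding elements. -/
theorem Hom.injective_homologyMap_iff (f : Hom V W) (n : ℤ) :
    Function.Injective (f.homologyMap n) ↔
      ∀ x ∈ V.gr n, V.d x = 0 → ∀ y ∈ W.gr (n + 1), W.d y = f.toLin x →
        ∃ z ∈ V.gr (n + 1), V.d z = x := by
  rw [injective_iff_map_eq_zero]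
  constructor
  · intro h x hx hdx y hy hyx
    exact (mk_cycle_eq_zero ⟨x, hx, hdx⟩).1
      (h (Submodule.Quotient.mk ⟨x, hx, hdx⟩) ((mk_cycle_eq_zero _).2 ⟨y, hy, hyx⟩))
  · intro h c hc
    obtain ⟨⟨x, hx, hdx⟩, rfl⟩ := Submodule.Quotient.mk_surjective _ c
    obtain ⟨y, hy, hyx⟩ := (mk_cycle_eq_zero _).1 hc
    exact (mk_cycle_eq_zero _).2 (h x hx hdx y hy hyx)

theorem Hom.surjective_homologyMap_iff (f : Hom V W) (n : ℤ) :
    Function.Surjective (f.homologyMap n) ↔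
      ∀ y ∈ W.gr n, W.d y = 0 → ∃ x ∈ V.gr n, V.d x = 0 ∧
        ∃ z ∈ W.gr (n + 1), W.d z = f.toLin x - y := by
  constructor
  · intro h y hy hdy
    obtain ⟨c, hc⟩ := h (Submodule.Quotient.mk ⟨y, hy, hdy⟩)
    obtain ⟨⟨x, hx, hdx⟩, rfl⟩ := Submodule.Quotient.mk_surjective _ c
    exact ⟨x, hx, hdx, (Submodule.Quotient.eq _).1 hc⟩
  · intro h c
    obtain ⟨⟨y, hy, hdy⟩, rfl⟩ := Submodule.Quotient.mk_surjective _ c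
    obtain ⟨x, hx, hdx, hz⟩ := h y hy hdy
    exact ⟨Submodule.Quotient.mk ⟨x, hx, hdx⟩, (Submodule.Quotient.eq _).2 hz⟩

theorem IsNonneg.eq_zero (hV : V.IsNonneg) {n : ℤ} (hn : n < 0) {x : V} (hx : x ∈ V.gr n) :
    x = 0 := by
  rw [hV n hn] at hx
  exact hx

/-- Negative degrees contain only 0. With `0 ≤ n` the bounding elements have degree at least `n + 1
> 0`, which is where fibrations are surjective and where `red₀` imposes no condition. -/
theorem Hom.isQuasiIso_of_nonneg (hV : V.IsNonneg) (hW : W.IsNonneg) (f : Hom V W)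
    (h₁ : ∀ n : ℤ, 0 ≤ n → ∀ x ∈ V.gr n, V.d x = 0 → ∀ y ∈ W.gr (n + 1), W.d y = f.toLin x →
      ∃ z ∈ V.gr (n + 1), V.d z = x)
    (h₂ : ∀ n : ℤ, 0 ≤ n → ∀ y ∈ W.gr n, W.d y = 0 → ∃ x ∈ V.gr n, V.d x = 0 ∧
      ∃ z ∈ W.gr (n + 1), W.d z = f.toLin x - y) : f.IsQuasiIso := by
  intro n
  rw [Function.Bijective, f.injective_homologyMap_iff, f.surjective_homologyMap_iff]
  rcases le_or_gt 0 n with hn | hn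
  · exact ⟨h₁ n hn, h₂ n hn⟩
  · refine ⟨fun x hx _ _ _ _ => ⟨0, Submodule.zero_mem _, ?_⟩,
      fun y hy _ => ⟨0, Submodule.zero_mem _, map_zero _, 0, Submodule.zero_mem _, ?_⟩⟩
    · rw [hV.eq_zero hn hx, map_zero]
    · rw [hW.eq_zero hn hy, map_zero, map_zero, sub_zero]

end DGMod

/-! ### Formal properties of weak equivalences of algebras -/

namespace Alg

variable {O : Operad k}

theorem lin_gr {X Y : Alg O} (f : X ⟶ Y) {n : ℤ} {x : X.mod} (hx : x ∈ X.mod.gr n) :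
    lin f x ∈ Y.mod.gr n := f.map_gr n x hx

theorem lin_d {X Y : Alg O} (f : X ⟶ Y) (x : X.mod) : lin f (X.mod.d x) = Y.mod.d (lin f x) :=
  f.map_d x

theorem lin_congr {X Y : Alg O} {f g : X ⟶ Y} (h : f = g) (x : X.mod) : lin f x = lin g x := by
  rw [h]

theorem homologyMap_comp {X Y Z : Alg O} (f : X ⟶ Y) (g : Y ⟶ Z) (n : ℤ) :
    ⇑((UAlg.Hom.toHom (f ≫ g)).homologyMap n) =
      (UAlg.Hom.toHom g).homologyMap n ∘ (UAlg.Hom.toHom f).homologyMap n := by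
  ext c
  obtain ⟨x, rfl⟩ := Submodule.Quotient.mk_surjective _ c
  rfl

theorem homologyMap_id (X : Alg O) (n : ℤ) :
    ⇑((UAlg.Hom.toHom (𝟙 X)).homologyMap n) = _root_.id := by
  ext c
  obtain ⟨x, rfl⟩ := Submodule.Quotient.mk_surjective _ c
  rfl

instance : (weakEquivalences O).HasTwoOutOfThreeProperty where
  comp_mem f g hf hg n := by
    rw [homologyMap_comp]
    exact (hg n).comp (hf n)
  of_postcomp f g hg hfg n := by
    have h := hfg n
    rw [homologyMap_comp] at h
    exact (Function.Bijective.of_comp_iff' (hg n) _).1 h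
  of_precomp f g hf hfg n := by
    have h := hfg n
    rw [homologyMap_comp] at h
    exact (Function.Bijective.of_comp_iff _ (hf n)).1 h

theorem weakEquivalences_of_isIso {X Y : Alg O} (f : X ⟶ Y) [IsIso f] : weakEquivalences O f := by
  intro n
  refine Function.bijective_iff_has_inverse.2
    ⟨(UAlg.Hom.toHom (inv f)).homologyMap n, fun c => ?_, fun c => ?_⟩
  · have h := congrFun (homologyMap_comp f (inv f) n) c
    rw [IsIso.hom_inv_id, homologyMap_id] at h
    exact h.symm
  · have h := congrFun (homologyMap_comp (inv f) f n) c
    rw [IsIso.inv_hom_id, homologyMap_id] at h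
    exact h.symm

/-- A morphism with a section that is homotopic to the identity on cycles is a weak equivalence,
as is its section. -/
theorem weakEquivalences_of_retraction {X Y : Alg O} (p : Y ⟶ X) (s : X ⟶ Y) (hsp : s ≫ p = 𝟙 X)
    (h : ∀ n : ℤ, 0 ≤ n → ∀ y ∈ Y.mod.gr n, Y.mod.d y = 0 →
      ∃ z ∈ Y.mod.gr (n + 1), Y.mod.d z = lin s (lin p y) - y) :
    weakEquivalences O s ∧ weakEquivalences O p := by
  have hs : weakEquivalences O s := by
    refine DGMod.Hom.isQuasiIso_of_nonneg X.nonneg Y.nonneg _ ?_ ?_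
    · intro n _ x _ _ y hy hyx
      -- Applying `p` to an element bounding `s x` gives one bounding `p (s x) = x`; a section is
      -- injective on homology without any homotopy.
      refine ⟨lin p y, lin_gr p hy, ?_⟩
      rw [← lin_d, hyx]
      exact lin_congr hsp x
    · intro n hn y hy hdy
      refine ⟨lin p y, lin_gr p hy, ?_, h n hn y hy hdy⟩
      rw [← lin_d, hdy, map_zero]
  refine ⟨hs, (weakEquivalences O).of_precomp s p hs ?_⟩
  rw [hsp]
  exact weakEquivalences_of_isIso _

/-! ### Weak equivalences of fibre products -/

open Limits

/-- The given pullback is known only by its universal property. The explicit fibre product has the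
wanted element `(x, y)`, and the canonical morphism carries it over. -/
theorem isPullback_exists {P X Y Z : Alg O} {fst : P ⟶ X} {snd : P ⟶ Y} {g : X ⟶ Z} {f : Y ⟶ Z}
    (hP : IsPullback fst snd g f) {n : ℤ} {x : X.mod} {y : Y.mod} (hx : x ∈ X.mod.gr n)
    (hy : y ∈ Y.mod.gr n) (h : lin g x = lin f y) :
    ∃ w ∈ P.mod.gr n, lin fst w = x ∧ lin snd w = y := by
  have hxy : (x, y) ∈ (UAlg.pullbackData g f).S n := ⟨⟨hx, hy⟩, sub_eq_zero.2 h⟩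
  let w : (fibreProduct g f).mod := ⟨(x, y), Submodule.mem_iSup_of_mem n hxy⟩
  have hw : w ∈ (fibreProduct g f).mod.gr n := hxy
  let e := hP.lift (fibreFst g f) (fibreSnd g f) (fibre_condition g f)
  exact ⟨lin e w, lin_gr e hw, lin_congr (hP.lift_fst _ _ (fibre_condition g f)) w,
    lin_congr (hP.lift_snd _ _ (fibre_condition g f)) w⟩

/-- The canonical morphism to the explicit fibre product has a left inverse, and elements of the
explicit fibre product are determined by their projections. -/
theorem isPullback_ext {P X Y Z : Alg O} {fst : P ⟶ X} {snd : P ⟶ Y} {g : X ⟶ Z} {f : Y ⟶ Z}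
    (hP : IsPullback fst snd g f) {w w' : P.mod} (h₁ : lin fst w = lin fst w')
    (h₂ : lin snd w = lin snd w') : w = w' := by
  let e := fibreLift g f fst snd hP.w
  let e' := hP.lift (fibreFst g f) (fibreSnd g f) (fibre_condition g f)
  have hee : e ≫ e' = 𝟙 P := by
    apply hP.hom_ext
    · rw [Category.assoc, hP.lift_fst, Category.id_comp]
      rfl
    · rw [Category.assoc, hP.lift_snd, Category.id_comp]
      rfl
  have h : lin e w = lin e w' := fibre_ext h₁ h₂
  exact (lin_congr hee w).symm.trans ((congrArg (lin e') h).trans (lin_congr hee w'))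

/-- The gluing lemma: a morphism of cospans consisting of weak equivalences induces a weak
equivalence of pullbacks if one leg of each cospan is a fibration. -/
theorem weakEquivalences_of_isPullback {P X Y Z P' X' Y' Z' : Alg O}
    {fst : P ⟶ X} {snd : P ⟶ Y} {g : X ⟶ Z} {f : Y ⟶ Z} (hP : IsPullback fst snd g f)
    {fst' : P' ⟶ X'} {snd' : P' ⟶ Y'} {g' : X' ⟶ Z'} {f' : Y' ⟶ Z'}
    (hP' : IsPullback fst' snd' g' f') (hf : fibrations O f) (hf' : fibrations O f')
    (φ : P ⟶ P') {a : X ⟶ X'} {b : Y ⟶ Y'} {c : Z ⟶ Z'}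
    (hφ₁ : φ ≫ fst' = fst ≫ a) (hφ₂ : φ ≫ snd' = snd ≫ b)
    (hg : g ≫ c = a ≫ g') (hfc : f ≫ c = b ≫ f')
    (ha : weakEquivalences O a) (hb : weakEquivalences O b) (hc : weakEquivalences O c) :
    weakEquivalences O φ := by
  have φ₁ : ∀ w, lin fst' (lin φ w) = lin a (lin fst w) := lin_congr hφ₁
  have φ₂ : ∀ w, lin snd' (lin φ w) = lin b (lin snd w) := lin_congr hφ₂
  have gc : ∀ x, lin c (lin g x) = lin g' (lin a x) := lin_congr hg
  have fc : ∀ y, lin c (lin f y) = lin f' (lin b y) := lin_congr hfc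
  have wP : ∀ w, lin g (lin fst w) = lin f (lin snd w) := lin_congr hP.w
  have wP' : ∀ w, lin g' (lin fst' w) = lin f' (lin snd' w) := lin_congr hP'.w
  have aI := fun n => ((UAlg.Hom.toHom a).injective_homologyMap_iff n).1 (ha n).1
  have aS := fun n => ((UAlg.Hom.toHom a).surjective_homologyMap_iff n).1 (ha n).2
  have bI := fun n => ((UAlg.Hom.toHom b).injective_homologyMap_iff n).1 (hb n).1
  have bS := fun n => ((UAlg.Hom.toHom b).surjective_homologyMap_iff n).1 (hb n).2
  have cI := fun n => ((UAlg.Hom.toHom c).injective_homologyMap_iff n).1 (hc n).1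
  have cS := fun n => ((UAlg.Hom.toHom c).surjective_homologyMap_iff n).1 (hc n).2
  -- The six criteria are restated with `lin`, so that `lin_d` and the commutation relations above
  -- can rewrite in them.
  change ∀ n, ∀ x ∈ X.mod.gr n, X.mod.d x = 0 → ∀ y ∈ X'.mod.gr (n + 1), X'.mod.d y = lin a x →
        ∃ z ∈ X.mod.gr (n + 1), X.mod.d z = x at aI
  change ∀ n, ∀ x ∈ Y.mod.gr n, Y.mod.d x = 0 → ∀ y ∈ Y'.mod.gr (n + 1), Y'.mod.d y = lin b x →
        ∃ z ∈ Y.mod.gr (n + 1), Y.mod.d z = x at bI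
  change ∀ n, ∀ x ∈ Z.mod.gr n, Z.mod.d x = 0 → ∀ y ∈ Z'.mod.gr (n + 1), Z'.mod.d y = lin c x →
        ∃ z ∈ Z.mod.gr (n + 1), Z.mod.d z = x at cI
  change ∀ n, ∀ y ∈ X'.mod.gr n, X'.mod.d y = 0 → ∃ x ∈ X.mod.gr n, X.mod.d x = 0 ∧
        ∃ z ∈ X'.mod.gr (n + 1), X'.mod.d z = lin a x - y at aS
  change ∀ n, ∀ y ∈ Y'.mod.gr n, Y'.mod.d y = 0 → ∃ x ∈ Y.mod.gr n, Y.mod.d x = 0 ∧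
        ∃ z ∈ Y'.mod.gr (n + 1), Y'.mod.d z = lin b x - y at bS
  change ∀ n, ∀ y ∈ Z'.mod.gr n, Z'.mod.d y = 0 → ∃ x ∈ Z.mod.gr n, Z.mod.d x = 0 ∧
        ∃ z ∈ Z'.mod.gr (n + 1), Z'.mod.d z = lin c x - y at cS
  refine DGMod.Hom.isQuasiIso_of_nonneg P.nonneg P'.nonneg _ ?_ ?_
  · intro n hn w hw hdw w' hw' hdw'
    replace hdw' : P'.mod.d w' = lin φ w := hdw'
    -- Injectivity on homology. The components of `w` bound separately, by `x₁` and `y₁`, but these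
    -- need not agree in `Z`.
    obtain ⟨x₁, hx₁, hdx₁⟩ := aI n (lin fst w) (lin_gr _ hw) (by rw [← lin_d, hdw, map_zero])
      (lin fst' w') (lin_gr _ hw') (by rw [← lin_d, hdw', φ₁])
    obtain ⟨y₁, hy₁, hdy₁⟩ := bI n (lin snd w) (lin_gr _ hw) (by rw [← lin_d, hdw, map_zero])
      (lin snd' w') (lin_gr _ hw') (by rw [← lin_d, hdw', φ₂])
    -- The elements `a x₁` and `fst' w'` have the same boundary. Subtracting from `x₁` a cycle `x₂`
    -- of `X` makes them equal up to the boundary of `x₃`; the same is then done for `y₁`.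
    obtain ⟨x₂, hx₂, hdx₂, x₃, hx₃, hdx₃⟩ := aS (n + 1) (lin a x₁ - lin fst' w')
      (Submodule.sub_mem _ (lin_gr _ hx₁) (lin_gr _ hw'))
      (by rw [map_sub, ← lin_d, ← lin_d, hdx₁, hdw', φ₁, sub_self])
    obtain ⟨y₂, hy₂, hdy₂, y₃, hy₃, hdy₃⟩ := bS (n + 1) (lin b y₁ - lin snd' w')
      (Submodule.sub_mem _ (lin_gr _ hy₁) (lin_gr _ hw'))
      (by rw [map_sub, ← lin_d, ← lin_d, hdy₁, hdw', φ₂, sub_self])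
    -- After these corrections the disagreement in `Z` is a cycle whose image in `Z'` is the
    -- boundary of `f' y₃ - g' x₃`, because the components of `w'` agree in `Z'`. Hence it is the
    -- boundary of some `z₁`.
    obtain ⟨z₁, hz₁, hdz₁⟩ := cI (n + 1) (lin g (x₁ - x₂) - lin f (y₁ - y₂))
      (Submodule.sub_mem _ (lin_gr _ (Submodule.sub_mem _ hx₁ hx₂))
        (lin_gr _ (Submodule.sub_mem _ hy₁ hy₂)))
      (by rw [map_sub, ← lin_d, ← lin_d, map_sub X.mod.d, map_sub Y.mod.d, hdx₁, hdx₂, hdy₁, hdy₂,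
        sub_zero, sub_zero, wP, sub_self])
      (lin f' y₃ - lin g' x₃) (Submodule.sub_mem _ (lin_gr _ hy₃) (lin_gr _ hx₃))
      (by
        rw [map_sub, ← lin_d, ← lin_d, hdx₃, hdy₃]
        simp only [map_sub, gc, fc, wP']
        abel)
    -- Adding `d y₄`, with `y₄` a lift of `z₁`, removes the disagreement without changing the
    -- boundary of the `Y` component.
    obtain ⟨y₄, hy₄, hfy₄⟩ := hf (n + 1 + 1) (by omega) z₁ hz₁
    obtain ⟨v, hv, hv₁, hv₂⟩ := isPullback_exists hP (n := n + 1) (x := x₁ - x₂)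
      (y := y₁ - y₂ + Y.mod.d y₄) (Submodule.sub_mem _ hx₁ hx₂)
      (Submodule.add_mem _ (Submodule.sub_mem _ hy₁ hy₂) (Y.mod.d_mem _ _ hy₄))
      (by rw [map_add, lin_d, hfy₄, hdz₁]; abel)
    refine ⟨v, hv, isPullback_ext hP ?_ ?_⟩
    · rw [lin_d, hv₁, map_sub, hdx₁, hdx₂, sub_zero]
    · rw [lin_d, hv₂, map_add, map_sub, hdy₁, hdy₂, Y.mod.d_d, sub_zero, add_zero]
  · intro n hn w' hw' hdw'
    -- Surjectivity on homology. The components of `w'` are represented by cycles `x₁` and `y₁`,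
    -- with homotopies `x₂` and `y₂`; both the cycles and the homotopies have to be made compatible
    -- over the base.
    obtain ⟨x₁, hx₁, hdx₁, x₂, hx₂, hdx₂⟩ := aS n (lin fst' w') (lin_gr _ hw')
      (by rw [← lin_d, hdw', map_zero])
    obtain ⟨y₁, hy₁, hdy₁, y₂, hy₂, hdy₂⟩ := bS n (lin snd' w') (lin_gr _ hw')
      (by rw [← lin_d, hdw', map_zero])
    obtain ⟨z₁, hz₁, hdz₁⟩ := cI n (lin g x₁ - lin f y₁)
      (Submodule.sub_mem _ (lin_gr _ hx₁) (lin_gr _ hy₁))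
      (by rw [map_sub, ← lin_d, ← lin_d, hdx₁, hdy₁, map_zero, map_zero, sub_self])
      (lin g' x₂ - lin f' y₂) (Submodule.sub_mem _ (lin_gr _ hx₂) (lin_gr _ hy₂))
      (by
        rw [map_sub, ← lin_d, ← lin_d, hdx₂, hdy₂, map_sub, map_sub, map_sub, gc, fc, wP']
        abel)
    -- Replacing `y₁` by `y₁ + d y₃` makes the cycles agree in `Z`, and correspondingly `y₂` becomes
    -- `y₂ + b y₃`.
    obtain ⟨y₃, hy₃, hfy₃⟩ := hf (n + 1) (by omega) z₁ hz₁
    -- The disagreement of the homotopies is now a cycle of `Z'` of degree `n + 1`. Up to the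
    -- boundary of `z₃` it comes from a cycle `z₂` of `Z`.
    obtain ⟨z₂, hz₂, hdz₂, z₃, hz₃, hdz₃⟩ := cS (n + 1)
      (lin g' x₂ - lin f' (y₂ + lin b y₃))
      (Submodule.sub_mem _ (lin_gr _ hx₂) (lin_gr _ (Submodule.add_mem _ hy₂ (lin_gr _ hy₃))))
      (by
        rw [map_sub, ← lin_d, ← lin_d, map_add, ← lin_d, hdx₂, hdy₂]
        simp only [map_sub, map_add]
        rw [← gc, ← fc, ← fc, lin_d f, hfy₃, hdz₁, wP', map_sub]
        abel)
    -- The lift `y₄` of `z₂` corrects the homotopy through `b y₄`. It adds `d y₄` to the cycle in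
    -- `Y`, which is harmless over `Z` since `f (d y₄) = d z₂ = 0`. The remaining boundary is
    -- absorbed by `d y₅`; this is where `f'` has to be a fibration.
    obtain ⟨y₄, hy₄, hfy₄⟩ := hf (n + 1) (by omega) z₂ hz₂
    obtain ⟨y₅, hy₅, hfy₅⟩ := hf' (n + 1 + 1) (by omega) z₃ hz₃
    have hY : y₃ + y₄ ∈ Y.mod.gr (n + 1) := Submodule.add_mem _ hy₃ hy₄
    obtain ⟨v, hv, hv₁, hv₂⟩ := isPullback_exists hP (n := n) (x := x₁)
      (y := y₁ + Y.mod.d (y₃ + y₄)) hx₁ (Submodule.add_mem _ hy₁ (Y.mod.d_mem _ _ hY))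
      (by rw [map_add, lin_d, map_add, map_add, hfy₃, hfy₄, hdz₁, hdz₂]; abel)
    obtain ⟨v', hv', hv₁', hv₂'⟩ := isPullback_exists hP' (n := n + 1) (x := x₂)
      (y := y₂ + lin b (y₃ + y₄) - Y'.mod.d y₅) hx₂
      (Submodule.sub_mem _ (Submodule.add_mem _ hy₂ (lin_gr _ hY)) (Y'.mod.d_mem _ _ hy₅))
      (by
        rw [map_sub, lin_d, hfy₅, hdz₃, ← hfy₄, fc]
        simp only [map_add]
        abel)
    refine ⟨v, hv, isPullback_ext hP ?_ ?_, v', hv', isPullback_ext hP' ?_ ?_⟩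
    · rw [lin_d, hv₁, hdx₁, map_zero]
    · rw [lin_d, hv₂, map_add, Y.mod.d_d, hdy₁, add_zero, map_zero]
    · rw [lin_d, hv₁', hdx₂, map_sub, ← hv₁]
      exact congrArg (· - _) (φ₁ v).symm
    · rw [lin_d, hv₂', map_sub, Y'.mod.d_d, map_add, ← lin_d, hdy₂, sub_zero, map_sub]
      refine Eq.trans ?_ (congrArg (· - _) (φ₂ v).symm)
      rw [hv₂]
      simp only [map_add]
      abel

end Alg

end QuasiIso

/-! ### The Poincaré lemma for `Λ(t, dt) ⊗ Z` -/

section Poincare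

open Polynomial

variable {k : Type u} [Field k]

/-- The primitive of a polynomial with vanishing constant coefficient. -/
noncomputable def polyPrim : k[X] →ₗ[k] k[X] :=
  Polynomial.lsum fun n => (Polynomial.monomial (n + 1)).comp (LinearMap.lsmul k k ((n + 1 : k)⁻¹))

theorem polyPrim_monomial (n : ℕ) (c : k) :
    polyPrim (monomial n c) = monomial (n + 1) ((n + 1 : k)⁻¹ * c) := by
  simp [polyPrim, Polynomial.lsum_apply]

theorem derivative_polyPrim [CharZero k] (P : k[X]) : derivative (polyPrim P) = P := by
  induction P using Polynomial.induction_on' with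
  | add P Q h₁ h₂ => rw [map_add, map_add, h₁, h₂]
  | monomial n c =>
    rw [polyPrim_monomial, derivative_monomial]
    -- Characteristic 0 is what makes the denominators in `polyPrim` invertible.
    have : (n + 1 : k) ≠ 0 := Nat.cast_add_one_ne_zero n
    congr 1
    push_cast
    field_simp

/-- The primitive of a polynomial vanishing at `c`. -/
noncomputable def polyPrimAt (c : k) : k[X] →ₗ[k] k[X] :=
  polyPrim - (Polynomial.monomial 0).comp ((Polynomial.leval c).comp polyPrim)

theorem derivative_polyPrimAt [CharZero k] (c : k) (P : k[X]) :
    derivative (polyPrimAt c P) = P := by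
  simp [polyPrimAt, derivative_polyPrim]

theorem eval_polyPrimAt (c : k) (P : k[X]) : (polyPrimAt c P).eval c = 0 := by
  simp [polyPrimAt]

/-- Both sides have derivative `P'`, so in characteristic 0 they differ by a constant, which
evaluation at `c` determines. -/
theorem polyPrimAt_derivative [CharZero k] (c : k) (P : k[X]) :
    polyPrimAt c (derivative P) = P - C (P.eval c) := by
  have h : derivative (polyPrimAt c (derivative P) - P) = 0 := by
    rw [derivative_sub, derivative_polyPrimAt, sub_self]
  have h₁ := Polynomial.eq_C_of_derivative_eq_zero h
  have h₂ := congrArg (Polynomial.eval c) h₁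
  rw [eval_sub, eval_polyPrimAt, zero_sub, eval_C] at h₂
  rw [← h₂, C_neg] at h₁
  rw [eq_add_of_sub_eq h₁]
  ring

variable (V : DGMod k)

/-- Integration from `c`: `Q ⊗ x ↦ (∫_c^t Q) ⊗ x`. -/
noncomputable def DGMod.integrate (c : k) : V.poly →ₗ[k] V.poly :=
  (polyPrimAt c).rTensor V

/-- The two maps act on different tensor factors. Consequently integration preserves degrees and
commutes with the differential of `k[t] ⊗ V`. -/
theorem DGMod.integrate_lTensor {V W : Type u} [AddCommGroup V] [Module k V] [AddCommGroup W]
    [Module k W] (I : k[X] →ₗ[k] k[X]) (f : V →ₗ[k] W) (w : k[X] ⊗[k] V) :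
    I.rTensor W (f.lTensor k[X] w) = f.lTensor k[X] (I.rTensor V w) := by
  rw [← LinearMap.comp_apply, ← LinearMap.comp_apply, LinearMap.rTensor_comp_lTensor,
    LinearMap.lTensor_comp_rTensor]

variable {V}

theorem DGMod.integrate_mem (c : k) {n : ℤ} {w : V.poly} (hw : w ∈ V.poly.gr n) :
    V.integrate c w ∈ V.poly.gr n := by
  obtain ⟨z, rfl⟩ := hw
  exact ⟨_, (DGMod.integrate_lTensor _ _ _).symm⟩

theorem DGMod.integrate_d (c : k) (w : V.poly) :
    V.integrate c (V.poly.d w) = V.poly.d (V.integrate c w) :=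
  DGMod.integrate_lTensor _ _ _

variable [CharZero k]

theorem DGMod.deriv_integrate (c : k) (w : V.poly) : V.deriv (V.integrate c w) = w := by
  change k[X] ⊗[k] V at w
  change ((derivative (R := k)).rTensor V) ((polyPrimAt c).rTensor V w) = w
  rw [← LinearMap.comp_apply, ← LinearMap.rTensor_comp,
    show (derivative (R := k)) ∘ₗ polyPrimAt c = LinearMap.id from
      LinearMap.ext (derivative_polyPrimAt c), LinearMap.rTensor_id]
  rfl

variable (V) in
/-- `x ↦ 1 ⊗ x`. -/
noncomputable def DGMod.const : V →ₗ[k] V.poly := TensorProduct.mk k k[X] V 1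

/-- The fundamental theorem of calculus with coefficients in `V`. The term `1 ⊗ w(c)` is what the
homotopy on the path object has to produce. -/
theorem DGMod.integrate_deriv (c : k) (w : V.poly) :
    V.integrate c (V.deriv w) = w - V.const ((V.evalHom c).toLin w) := by
  have h : V.integrate c ∘ₗ V.deriv = LinearMap.id - V.const ∘ₗ (V.evalHom c).toLin := by
    refine TensorProduct.ext' fun P x => ?_
    refine Eq.trans (b := (P - C (P.eval c)) ⊗ₜ[k] x) ?_ ?_
    · exact congrArg (· ⊗ₜ[k] x) (polyPrimAt_derivative c P)
    -- The constant `P(c)` is moved across the tensor sign, turning `C (P(c)) ⊗ x` into `1 ⊗ P(c)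
    -- x`.
    · rw [TensorProduct.sub_tmul, ← mul_one (C _), ← Polynomial.smul_eq_C_mul,
        ← TensorProduct.smul_tmul', ← TensorProduct.tmul_smul]
      rfl
  exact congrArg (fun g => g w) h

end Poincare

/-! ### The path object: contraction to constant paths and endpoints -/

section PathObject

open Polynomial

variable {k : Type u} [Field k] [CharZero k] {O : Operad k}

namespace Alg

/-- A homogeneous element of the path object. -/
theorem path_exists (Z : Alg O) {n : ℤ} (hn : 0 < n) {u v : Z.mod.poly} (hu : u ∈ Z.mod.poly.gr n)
    (hv : v ∈ Z.mod.poly.gr (n + 1)) :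
    ∃ w ∈ (path Z).mod.gr n, w.1.1 = u ∧ w.1.2 = v := by
  -- In positive degree `red₀` imposes no condition; in degree 0 the pair would have to be a cycle.
  have h : ((u, v) : Z.toUAlg.lambdaTensor.mod) ∈ UAlg.red0Sub Z.toUAlg.lambdaTensor.mod n :=
    UAlg.mem_red0Sub.2 ⟨⟨hu, hv⟩, fun h => absurd h hn.ne', fun h => absurd h hn.not_gt⟩
  exact ⟨⟨(u, v), Submodule.mem_iSup_of_mem n h⟩, h, rfl, rfl⟩

theorem lin_pathEval (c : k) (Z : Alg O) (w : (path Z).mod) :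
    lin (pathEval c Z) w = evalAt Z.mod c w.1.1 := rfl

/-- The homotopy is integration of the `dt` component from `c`: if `u + dt v` is a cycle, the
integral of `v` has differential `(u - u(c)) + dt v`. -/
theorem weakEquivalences_pathEval (c : k) (Z : Alg O) :
    weakEquivalences O (s0 Z) ∧ weakEquivalences O (pathEval c Z) := by
  refine weakEquivalences_of_retraction _ _ (s0_pathEval c Z) ?_
  intro n hn w hw hdw
  have hw' := (UAlg.mem_red0Sub.1 hw).1
  obtain ⟨u, hu⟩ : ∃ u : Z.mod.poly, w.1.1 = u := ⟨_, rfl⟩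
  obtain ⟨v, hv⟩ : ∃ v : Z.mod.poly, w.1.2 = v := ⟨_, rfl⟩
  have hvn : v ∈ Z.mod.poly.gr (n + 1) := hv ▸ hw'.2
  -- This is the `dt` component of the cycle condition, since `d (u + dt v) = d u + dt (∂u - d v)`.
  have hd : Z.mod.deriv u = Z.mod.poly.d v :=
    hu ▸ hv ▸ sub_eq_zero.1 (congrArg (fun z : (path Z).mod => z.1.2) hdw)
  -- As `dt` has degree `-1`, the coefficient `v` has degree `n + 1`, so its integral has the degree
  -- required of a homotopy. It lies in the path object because `n + 1 > 0`.
  obtain ⟨z, hz, hz₁, hz₂⟩ := path_exists Z (n := n + 1) (by omega)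
    (DGMod.integrate_mem c hvn) (Submodule.zero_mem _)
  -- The sign is due to the orientation `s p w - w` in the retraction criterion, whereas `d z = w -
  -- s p w`.
  refine ⟨-z, Submodule.neg_mem _ hz, ?_⟩
  rw [map_neg, neg_eq_iff_eq_neg, neg_sub]
  refine Subtype.ext (Prod.ext ?_ ?_)
  · refine (congrArg Z.mod.poly.d hz₁).trans ?_
    rw [← DGMod.integrate_d, ← hd, DGMod.integrate_deriv, ← hu]
    rfl
  · refine (congrArg₂ (fun a b => Z.mod.deriv a - Z.mod.poly.d b) hz₁ hz₂).trans ?_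
    rw [DGMod.deriv_integrate, map_zero, sub_zero, ← hv]
    exact (sub_zero _).symm

theorem surjective_pathEval (c : k) (Z : Alg O) : Function.Surjective (lin (pathEval c Z)) :=
  fun z => ⟨lin (s0 Z) z, lin_congr (s0_pathEval c Z) z⟩

theorem fibrations_pathEval (c : k) (Z : Alg O) : fibrations O (pathEval c Z) :=
  fun _ _ z hz => ⟨lin (s0 Z) z, lin_gr _ hz, lin_congr (s0_pathEval c Z) z⟩

/-- The path is the segment `(1 - t) z₀ + t z₁`, with no `dt` component. It need not be a cycle, so
positive degree is needed for it to lie in `Z^I`. -/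
theorem path_endpoints (Z : Alg O) {n : ℤ} (hn : 0 < n) {z₀ z₁ : Z.mod} (h₀ : z₀ ∈ Z.mod.gr n)
    (h₁ : z₁ ∈ Z.mod.gr n) :
    ∃ w ∈ (path Z).mod.gr n, lin (p0 Z) w = z₀ ∧ lin (p1 Z) w = z₁ := by
  have hmem : ∀ (P : k[X]) {z : Z.mod}, z ∈ Z.mod.gr n →
      (P ⊗ₜ[k] z : k[X] ⊗[k] Z.mod) ∈ Z.mod.poly.gr n :=
    fun P z hz => ⟨P ⊗ₜ ⟨z, hz⟩, rfl⟩
  obtain ⟨w, hw, hw₁, -⟩ := path_exists Z hn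
    (Submodule.add_mem _ (hmem (1 - X) h₀) (hmem X h₁)) (Submodule.zero_mem _)
  refine ⟨w, hw, ?_, ?_⟩
  · rw [lin_pathEval, hw₁]
    refine (map_add (evalAt Z.mod 0) _ _).trans ?_
    simp
  · rw [lin_pathEval, hw₁]
    refine (map_add (evalAt Z.mod 1) _ _).trans ?_
    simp

/-! ### The factorisation `Y ⟶ Z^I ×_Z Y ⟶ Z` -/

open Limits

/-- The morphism is a section of the projection to `Y`, which is a base change of the fibration and
weak equivalence `p₀`. So it suffices that the projection is a weak equivalence. -/
theorem weakEquivalences_toMappingPath {Y Z : Alg O} (f : Y ⟶ Z) :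
    weakEquivalences O (toMappingPath f) := by
  have hid : ∀ W : Alg O, weakEquivalences O (𝟙 W) := fun W => weakEquivalences_of_isIso _
  have hs : weakEquivalences O (pullback.snd (p0 Z) f) :=
    -- Gluing is applied to the map of cospans from `Y ⟶ Z ⟵ Z^I` to `Y ⟶ Z ⟵ Z` whose only
    -- nontrivial component is `p₀`; the pullback of the second cospan is `Y`.
    weakEquivalences_of_isPullback (IsPullback.of_hasPullback (p0 Z) f).flip
      (IsPullback.of_horiz_isIso (fst := 𝟙 Y) (snd := f) (f := f) (g := 𝟙 Z) ⟨by simp⟩)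
      (fibrations_pathEval 0 Z) (fun _ _ z hz => ⟨z, hz, rfl⟩) (pullback.snd (p0 Z) f)
      (a := 𝟙 Y) (b := p0 Z) (c := 𝟙 Z) rfl pullback.condition.symm
      ((Category.comp_id f).trans (Category.id_comp f).symm) rfl (hid Y)
      (weakEquivalences_pathEval 0 Z).2 (hid Z)
  refine (weakEquivalences O).of_postcomp _ (pullback.snd (p0 Z) f) hs ?_
  rw [toMappingPath_snd]
  exact hid Y

theorem fibrations_mappingPathEnd {Y Z : Alg O} (f : Y ⟶ Z) : fibrations O (mappingPathEnd f) := by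
  intro n hn z hz
  -- A path from 0 to `z` starts at the image of `0 : Y`, so together with 0 it defines an element
  -- of `Z^I ×_Z Y` ending at `z`.
  obtain ⟨w, hw, hw₀, hw₁⟩ := path_endpoints Z hn (Submodule.zero_mem _) hz
  obtain ⟨v, hv, hv₁, -⟩ := isPullback_exists (IsPullback.of_hasPullback (p0 Z) f) hw
    (Submodule.zero_mem (Y.mod.gr n)) (by rw [hw₀, map_zero])
  exact ⟨v, hv, (congrArg (lin (p1 Z)) hv₁).trans hw₁⟩

/-- Both algebras `Z^I ×_Z Y` are weakly equivalent to their `Y`, so by two-out-of-three only the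
component `y` matters. -/
theorem weakEquivalences_mappingPathMap {Y Z Y' Z' : Alg O} (f : Y ⟶ Z) (f' : Y' ⟶ Z')
    (y : Y ⟶ Y') (z : Z ⟶ Z') (h : f ≫ z = y ≫ f') (hy : weakEquivalences O y) :
    weakEquivalences O (mappingPathMap f f' y z h) := by
  refine (weakEquivalences O).of_precomp (toMappingPath f) _ (weakEquivalences_toMappingPath f) ?_
  rw [toMappingPath_map]
  exact (weakEquivalences O).comp_mem _ _ hy (weakEquivalences_toMappingPath f')

/-! ### The homotopy pullback -/

/-- The right leg of the cospan defining `P_D` is a fibration for every `D`, so gluing applies with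
no assumption on the diagrams. -/
theorem weakEquivalences_modelMap {D D' : Cospan O} (φ : D ⟶ D')
    (hφ : cospanWeakEquivalences O φ) : weakEquivalences O ((model O).map φ) :=
  weakEquivalences_of_isPullback (IsPullback.of_hasPullback _ _) (IsPullback.of_hasPullback _ _)
    (fibrations_mappingPathEnd _) (fibrations_mappingPathEnd _) (modelMap φ)
    (modelMap_fst φ) (modelMap_snd φ) (cospan_naturality_left φ) (mappingPathMap_end _ _ _ _ _)
    (hφ _) (weakEquivalences_mappingPathMap _ _ _ _ _ (hφ _)) (hφ _)

/-- Here `c_D` is induced by a map of cospans that is the identity on `X` and `Z` and the weak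
equivalence `Y ⟶ Z^I ×_Z Y` on the right. Gluing therefore asks only that the original right leg be
a fibration. -/
theorem weakEquivalences_comparisonApp (D : Cospan O)
    (hD : fibrations O (D.map WalkingCospan.Hom.inr)) :
    weakEquivalences O ((comparison O).app D) :=
  weakEquivalences_of_isPullback (IsPullback.of_isLimit_cone (limit.isLimit D))
    (IsPullback.of_hasPullback _ _) hD (fibrations_mappingPathEnd _) (comparisonApp D)
    (a := 𝟙 _) (b := toMappingPath _) (c := 𝟙 _)
    ((comparisonApp_fst D).trans (Category.comp_id _).symm) (comparisonApp_snd D)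
    ((Category.comp_id _).trans (Category.id_comp _).symm)
    ((Category.comp_id _).trans (toMappingPath_end _).symm)
    (weakEquivalences_of_isIso _) (weakEquivalences_toMappingPath _) (weakEquivalences_of_isIso _)

/-- The functorial fibrant replacement of `X ⟶ Z ⟵ Y`: the diagram
`X ×_Z Z^I ⟶ Z ⟵ Z^I ×_Z Y`. -/
noncomputable def fibrantReplacement (O : Operad k) : Cospan O ⥤ Cospan O where
  obj D := cospan (mappingPathEnd (D.map WalkingCospan.Hom.inl))
    (mappingPathEnd (D.map WalkingCospan.Hom.inr))
  map {D D'} φ := cospanHomMk (φ.app WalkingCospan.one)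
    (mappingPathMap (D.map WalkingCospan.Hom.inl) (D'.map WalkingCospan.Hom.inl) _ _
      (cospan_naturality_left φ))
    (mappingPathMap (D.map WalkingCospan.Hom.inr) (D'.map WalkingCospan.Hom.inr) _ _
      (cospan_naturality_right φ))
    (mappingPathMap_end _ _ _ _ _) (mappingPathMap_end _ _ _ _ _)
  map_id D := by
    ext (_ | _ | _)
    · rfl
    · exact mappingPathMap_id (D.map WalkingCospan.Hom.inl)
        ((Category.comp_id _).trans (Category.id_comp _).symm)
    · exact mappingPathMap_id (D.map WalkingCospan.Hom.inr)
        ((Category.comp_id _).trans (Category.id_comp _).symm)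
  map_comp φ ψ := by
    ext (_ | _ | _)
    · rfl
    · exact mappingPathMap_comp _ _ _ _ _ _ _ (cospan_naturality_left φ)
        (cospan_naturality_left ψ) (cospan_naturality_left (φ ≫ ψ))
    · exact mappingPathMap_comp _ _ _ _ _ _ _ (cospan_naturality_right φ)
        (cospan_naturality_right ψ) (cospan_naturality_right (φ ≫ ψ))

/-- The replacement morphism of a diagram. -/
noncomputable def toFibrantReplacement (O : Operad k) : 𝟭 (Cospan O) ⟶ fibrantReplacement O where
  app D := cospanHomMk (𝟙 _) (toMappingPath (D.map WalkingCospan.Hom.inl))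
    (toMappingPath (D.map WalkingCospan.Hom.inr))
    ((Category.comp_id _).trans (toMappingPath_end _).symm)
    ((Category.comp_id _).trans (toMappingPath_end _).symm)
  naturality D D' φ := by
    ext (_ | _ | _)
    · exact (Category.comp_id _).trans (Category.id_comp _).symm
    · exact (toMappingPath_map _ _ _ _ (cospan_naturality_left φ)).symm
    · exact (toMappingPath_map _ _ _ _ (cospan_naturality_right φ)).symm

theorem cospanWeakEquivalences_toFibrantReplacement (D : Cospan O) :
    cospanWeakEquivalences O ((toFibrantReplacement O).app D) := by
  rintro (_ | _ | _)
  · exact weakEquivalences_of_isIso (𝟙 _)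
  · exact weakEquivalences_toMappingPath _
  · exact weakEquivalences_toMappingPath _

theorem isFibrantCospan_fibrantReplacement (D : Cospan O) :
    IsFibrantCospan ((fibrantReplacement O).obj D) :=
  ⟨fibrations_mappingPathEnd _, fibrations_mappingPathEnd _⟩

end Alg

end PathObject

/-! ### Right derived functors from functorial replacements -/

section Derived

/-- A functor `RF` on the localization is a right derived functor of `F`, with unit `α`, if `α` is
invertible on the values of a functorial replacement. -/
theorem isRightDerivedFunctor_of_replacement {C D H : Type*} [Category* C] [Category* D]
    [Category* H] (W : MorphismProperty C) (L : C ⥤ D) [L.IsLocalization W] {F : C ⥤ H}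
    (RF : D ⥤ H) (α : F ⟶ L ⋙ RF) (R : C ⥤ C) (η : 𝟭 C ⟶ R) (hη : ∀ X, W (η.app X))
    (hα : ∀ X, IsIso (α.app (R.obj X))) : RF.IsRightDerivedFunctor α W := by
  have hL : ∀ X, IsIso (L.map (η.app X)) := fun X => Localization.inverts L W _ (hη X)
  -- The component at `X` is the only possible one: pass to `R X` along `η`, which `L` inverts,
  -- invert `α` there, and come back after applying `β`. Functoriality of `R` makes it natural in
  -- `X`.
  let δ (G : D ⥤ H) (β : F ⟶ L ⋙ G) : L ⋙ RF ⟶ L ⋙ G :=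
    { app := fun X => RF.map (L.map (η.app X)) ≫ inv (α.app (R.obj X)) ≫ β.app (R.obj X) ≫
        inv (G.map (L.map (η.app X)))
      naturality := fun X Y f => by
        have h₁ : η.app X ≫ R.map f = f ≫ η.app Y := (η.naturality f).symm
        have h₂ := α.naturality (R.map f)
        have h₃ := β.naturality (R.map f)
        simp only [Functor.comp_map] at h₂ h₃ ⊢
        simp only [Category.assoc]
        rw [← RF.map_comp_assoc, ← L.map_comp, ← h₁, L.map_comp, RF.map_comp_assoc,
          ← cancel_mono (G.map (L.map (η.app Y)))]
        simp only [Category.assoc, IsIso.inv_hom_id, Category.comp_id, ← G.map_comp, ← L.map_comp,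
          ← h₁]
        rw [L.map_comp, G.map_comp, IsIso.inv_hom_id_assoc, ← h₃, cancel_epi,
          IsIso.eq_inv_comp, ← Category.assoc, ← h₂, Category.assoc, IsIso.hom_inv_id_assoc] }
  have hex (G : D ⥤ H) (β : F ⟶ L ⋙ G) :
      ∃ γ : RF ⟶ G, ∀ X, α.app X ≫ γ.app (L.obj X) = β.app X := by
    -- Natural transformations between functors restricted along a localization descend to the
    -- localization.
    refine ⟨Localization.liftNatTrans L W (L ⋙ RF) (L ⋙ G) RF G (δ G β), fun X => ?_⟩
    have h₁ := α.naturality (η.app X)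
    have h₂ := β.naturality (η.app X)
    simp only [Functor.comp_map, Functor.id_obj] at h₁ h₂
    have h : (Localization.liftNatTrans L W (L ⋙ RF) (L ⋙ G) RF G (δ G β)).app (L.obj X) =
        (δ G β).app X := by
      rw [Localization.liftNatTrans_app]
      -- The comparison isomorphisms of the lifting are identities here, since both functors are
      -- literally composites with `L`.
      exact (Category.id_comp _).trans (Category.comp_id _)
    rw [h]
    simp only [δ]
    rw [← reassoc_of% h₁, IsIso.hom_inv_id_assoc, reassoc_of% h₂, IsIso.hom_inv_id]
    exact Category.comp_id _
  have huniq (G : D ⥤ H) (γ γ' : RF ⟶ G)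
      (h : ∀ X, α.app X ≫ γ.app (L.obj X) = α.app X ≫ γ'.app (L.obj X)) : γ = γ' := by
    refine Localization.natTrans_ext L W fun X => ?_
    -- On replaced objects `α` is invertible and can be cancelled; naturality along the isomorphism
    -- `L (η X)` then carries the equality to `L X`.
    have hR : γ.app (L.obj (R.obj X)) = γ'.app (L.obj (R.obj X)) :=
      (cancel_epi (α.app (R.obj X))).1 (h _)
    have h₁ := γ.naturality (L.map (η.app X))
    have h₂ := γ'.naturality (L.map (η.app X))
    rw [hR] at h₁
    exact (cancel_mono (G.map (L.map (η.app X)))).1 (h₁.symm.trans h₂)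
  choose γ hγ using hex
  -- Being a right derived functor means that `(RF, α)` is initial among functors `G` on the
  -- localization equipped with a transformation `F ⟶ L ⋙ G`.
  refine ⟨⟨⟨Limits.IsInitial.ofUniqueHom (fun E => StructuredArrow.homMk (γ E.right E.hom)
    (NatTrans.ext (funext (hγ E.right E.hom)))) fun E m => ?_⟩⟩⟩
  refine StructuredArrow.ext _ _ (huniq _ _ _ fun X => ?_)
  exact (NatTrans.congr_app (StructuredArrow.w m) X).trans (hγ E.right E.hom X).symm

end Derived

/-! ### The model as the total right derived pullback -/

section Main

open Limits Alg

variable {k : Type u} [Field k] [CharZero k]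

theorem isHomotopyPullback_model (O : Operad k) : IsHomotopyPullback (model O) (comparison O) := by
  refine ⟨fun D D' φ hφ => weakEquivalences_modelMap φ hφ,
    fun D D' φ hφ => Localization.inverts (weakEquivalences O).Q (weakEquivalences O) _
      (weakEquivalences_modelMap φ hφ), ?_⟩
  refine isRightDerivedFunctor_of_replacement _ _ _ _ (fibrantReplacement O)
    (toFibrantReplacement O) cospanWeakEquivalences_toFibrantReplacement fun D => ?_
  -- On a replaced diagram the right leg is a fibration, so the comparison is a weak equivalence and
  -- becomes invertible in the homotopy category. The other factor of the unit is a component of a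
  -- natural isomorphism.
  have : IsIso ((Functor.whiskerRight (comparison O) (weakEquivalences O).Q).app
      ((fibrantReplacement O).obj D)) :=
    Localization.inverts (weakEquivalences O).Q (weakEquivalences O) _
      (weakEquivalences_comparisonApp _ (isFibrantCospan_fibrantReplacement D).2)
  rw [NatTrans.comp_app]
  exact IsIso.comp_isIso

end Main

end DGOperad
open CategoryTheory CategoryTheory.Limits DGOperad DGOperad.Alg in
theorem mainTheorem6 {k : Type u} [Field k] [CharZero k] (O : Operad k) (hO : O.IsReduced) :
    -- `Z^I` is a path object
    (∀ Z : Alg O,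
      (s0 Z ≫ p0 Z = 𝟙 Z ∧ s0 Z ≫ p1 Z = 𝟙 Z) ∧
      weakEquivalences O (s0 Z) ∧ weakEquivalences O (p0 Z) ∧ weakEquivalences O (p1 Z) ∧
      Function.Surjective (lin (p0 Z)) ∧ Function.Surjective (lin (p1 Z)) ∧
      ∀ n : ℤ, 0 < n → ∀ z₀ ∈ Z.mod.gr n, ∀ z₁ ∈ Z.mod.gr n,
        ∃ w ∈ (path Z).mod.gr n, lin (p0 Z) w = z₀ ∧ lin (p1 Z) w = z₁) ∧
    -- `D ↦ P_D` is a homotopy pullback functor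
    IsHomotopyPullback (model O) (comparison O) ∧
    -- comparison with the pullback of any fibrant replacement, and existence of the latter
    (∀ ⦃D D' : Cospan O⦄ (φ : D ⟶ D'), cospanWeakEquivalences O φ → IsFibrantCospan D' →
      weakEquivalences O ((model O).map φ) ∧ weakEquivalences O ((comparison O).app D')) ∧
    (∀ D : Cospan O, ∃ (D' : Cospan O) (φ : D ⟶ D'),
      cospanWeakEquivalences O φ ∧ IsFibrantCospan D') :=
  ⟨fun Z => ⟨⟨s0_pathEval 0 Z, s0_pathEval 1 Z⟩, (weakEquivalences_pathEval 0 Z).1,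
      (weakEquivalences_pathEval 0 Z).2, (weakEquivalences_pathEval 1 Z).2,
      surjective_pathEval 0 Z, surjective_pathEval 1 Z,
      fun _ hn _ h₀ _ h₁ => path_endpoints Z hn h₀ h₁⟩,
    isHomotopyPullback_model O,
    fun _ D' φ hφ hD' => ⟨weakEquivalences_modelMap φ hφ, weakEquivalences_comparisonApp D' hD'.2⟩,
    fun D => ⟨_, (toFibrantReplacement O).app D, cospanWeakEquivalences_toFibrantReplacement D,
      isFibrantCospan_fibrantReplacement D⟩⟩
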